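/- Let $F$ be a field, $\delta\in F$ and $r\in\mathbb N$. A diagram on $2r$ dots consists of two rows of $r$ dots (a top and a bottom row) together with a perfect matching of the $2r$ dots. The Brauer algebra $B_r(\delta)$ is the associative unital $F$-algebra whose basis is the set of all diagrams on $2r$ dots and whose multiplication is concatenation: to form $ab$, write $a$ on top of $b$, identify the bottom row of $a$ with the top row of $b$, follow the resulting paths between the outer dots, delete the closed loops that lie in the middle row, and multiply by $\delta^{m}$, where $m$ is the number of deleted loops. The cycle type of a diagram $d$ is defined as follows. Connect each dot in the top row of $d$ with the dot in the bottom row below it. Traverse each connected component of the resulting graph once, in either direction, and attach to it the absolute value of the difference between the number of edges of $d$ traversed downward (from the top to the bottom row) and the number traversed upward; horizontal edges do not count. The cycle type of $d$ is the multiset of these non-negative integers over all connected components, zeros included. **Theorem.** Let $\rho\colon B_r(\delta)\to M_n(F)$ be any matrix representation (a unital $F$-algebra homomorphism), and let $d_1,d_2$ be diagrams on $2r$ dots with the same cycle type. Then: 1. The matrices $\rho(d_1)$ and $\rho(d_2)$ have the same characteristic polynomial, and in particular the same eigenvalues in an algebraic closure of $F$, including algebraic multiplicities. 2. The minimal polynomials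 of $\rho(d_1)$ and $\rho(d_2)$ over $F$ differ only by a power of the indeterminate $x$, that is, one of them is $x^k$ times the other for some $k\ge 0$. In particular, every $0\neq\lambda\in F$ is an eigenvalue of $\rho(d_1)$ if and only if it is an eigenvalue of $\rho(d_2)$. 3. For every $0\neq\lambda\in F$ the eigenspaces of $\rho(d_1)$ and $\rho(d_2)$ for $\lambda$ have the same dimension. -/

import Mathlib

/-- A perfect matching on `X`, encoded by the fixed-point-free involution that sends each
point to its partner. -/
@[ext]
structure PerfectMatching (X : Type*) where
  partner : X → X
  partner_partner : ∀ x, partner (partner x) = x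
  partner_ne : ∀ x, partner x ≠ x

namespace PerfectMatching

variable {W X Y Z : Type*}

/-! ### Stacking two matchings -/

/-- The position of a dot of the upper diagram in the three-row picture. -/
def upper : X ⊕ Y → X ⊕ (Y ⊕ Z) := Sum.map id Sum.inl

/-- The position of a dot of the lower diagram in the three-row picture. -/
def lower : Y ⊕ Z → X ⊕ (Y ⊕ Z) := Sum.inr

/-- The position of an outer dot (top or bottom row) in the three-row picture. -/
def outer : X ⊕ Z → X ⊕ (Y ⊕ Z) := Sum.map id Sum.inr

/-- The edges of the three-row picture obtained by writing `a` on top of `b` and identifying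
the bottom row of `a` with the top row of `b`. -/
inductive StackEdge (a : PerfectMatching (X ⊕ Y)) (b : PerfectMatching (Y ⊕ Z)) :
    X ⊕ (Y ⊕ Z) → X ⊕ (Y ⊕ Z) → Prop
  | upper (p : X ⊕ Y) : StackEdge a b (upper p) (upper (a.partner p))
  | lower (p : Y ⊕ Z) : StackEdge a b (lower p) (lower (b.partner p))

/-- Two dots of the three-row picture are related if they lie in the same connected
component; the quotient is the set of connected components. -/
def stack (a : PerfectMatching (X ⊕ Y)) (b : PerfectMatching (Y ⊕ Z)) :
    Setoid (X ⊕ (Y ⊕ Z)) :=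
  Relation.EqvGen.setoid (StackEdge a b)

/-- The number of loops: connected components of the three-row picture that contain no dot
of the top or the bottom row. -/
noncomputable def loops (a : PerfectMatching (X ⊕ Y)) (b : PerfectMatching (Y ⊕ Z)) : ℕ :=
  Nat.card {c : Quotient (stack a b) // ∀ e : X ⊕ Z, Quotient.mk (stack a b) (outer e) ≠ c}

/-! ### Each component meeting an outer row has exactly two outer dots -/

section Dihedral

variable {P : Type*}

/-- One step along either of two involutions. -/
inductive InvStep (α β : P → P) : P → P → Prop
  | fst (p : P) : InvStep α β p (α p)
  | snd (p : P) : InvStep α β p (β p)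

theorem existsUnique_other_end [Finite P] (α β : P → P) (hα : ∀ p, α (α p) = p)
    (hβ : ∀ p, β (β p) = p) (hne : ∀ p, α p ≠ p) (x : P) (hx : β x = x) :
    ∃! y, y ≠ x ∧ β y = y ∧ Relation.EqvGen (InvStep α β) x y := by
  let τ : Equiv.Perm P := (Function.Involutive.toPerm α hα).trans (Function.Involutive.toPerm β hβ)
  have hτ : ∀ p, τ p = β (α p) := fun p => rfl
  have hτi : ∀ p, τ⁻¹ p = α (β p) := fun p => rfl
  have hβτ : ∀ i : ℤ, ∀ p, β ((τ ^ i) p) = (τ ^ (-i)) (β p) := by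
    have h1 : ∀ p, β (τ p) = τ⁻¹ (β p) := fun p => by rw [hτ, hτi, hβ, hβ]
    have h2 : ∀ p, β (τ⁻¹ p) = τ (β p) := fun p => by rw [hτ, hτi]
    intro i
    induction i using Int.induction_on with
    | zero => intro p; simp
    | succ n ih =>
      intro p
      rw [add_comm, zpow_add, zpow_one, Equiv.Perm.mul_apply, h1, ih, neg_add, zpow_add,
        zpow_neg_one, Equiv.Perm.mul_apply]
    | pred n ih =>
      intro p
      rw [sub_eq_neg_add, zpow_add, zpow_neg_one, Equiv.Perm.mul_apply, h2, ih,
        neg_add, neg_neg, neg_neg, zpow_add, zpow_one, Equiv.Perm.mul_apply]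
  have hβx : ∀ i : ℤ, β ((τ ^ i) x) = (τ ^ (-i)) x := fun i => by rw [hβτ, hx]
  have hαx : ∀ i : ℤ, α ((τ ^ i) x) = (τ ^ (-i - 1)) x := by
    intro i
    have : α ((τ ^ i) x) = β ((τ ^ (1 + i)) x) := by
      rw [zpow_add, zpow_one, Equiv.Perm.mul_apply, hτ, hβ]
    rw [this, hβx]
    congr 2
    ring
  obtain ⟨m, hm, hper⟩ : ∃ m : ℕ, 0 < m ∧ ∀ i : ℤ, (τ ^ i) x = x ↔ (m : ℤ) ∣ i := by
    refine ⟨Function.minimalPeriod (τ • ·) x, ?_, fun i => ?_⟩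
    · have : x ∈ Function.periodicPts (fun p => τ • p) :=
        Function.Injective.mem_periodicPts (MulAction.injective τ) x
      exact Function.minimalPeriod_pos_of_mem_periodicPts this
    · exact MulAction.zpow_smul_eq_iff_minimalPeriod_dvd (a := τ) (b := x) (n := i)
  have hper2 : ∀ i j : ℤ, (τ ^ i) x = (τ ^ j) x ↔ (m : ℤ) ∣ i - j := by
    intro i j
    rw [← hper, sub_eq_neg_add, zpow_add, Equiv.Perm.mul_apply, zpow_neg,
      Equiv.Perm.inv_eq_iff_eq]
  have heven : ∃ k : ℤ, (m : ℤ) = 2 * k := by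
    by_contra hcon
    have hodd : ∃ k : ℤ, (m : ℤ) = 2 * k + 1 := by
      rcases Int.even_or_odd' (m : ℤ) with ⟨k, hk | hk⟩
      · exact absurd ⟨k, hk⟩ hcon
      · exact ⟨k, hk⟩
    obtain ⟨k, hk⟩ := hodd
    refine hne ((τ ^ k) x) ?_
    rw [hαx, hper2]
    exact ⟨-1, by omega⟩
  obtain ⟨k, hk⟩ := heven
  have hpow : ∀ i : ℤ, Relation.EqvGen (InvStep α β) x ((τ ^ i) x) := by
    have hs : ∀ p, Relation.EqvGen (InvStep α β) p (τ p) := fun p =>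
      .trans _ _ _ (.rel _ _ (.fst p)) (.rel _ _ (.snd (α p)))
    intro i
    induction i using Int.induction_on with
    | zero => exact .refl _
    | succ n ih =>
      rw [add_comm, zpow_add, zpow_one, Equiv.Perm.mul_apply]
      exact .trans _ _ _ ih (hs _)
    | pred n ih =>
      rw [sub_eq_neg_add, zpow_add, zpow_neg_one, Equiv.Perm.mul_apply]
      refine .trans _ _ _ ih (.symm _ _ ?_)
      have := hs (τ⁻¹ ((τ ^ (-(n : ℤ))) x))
      rwa [hτi, hτ, hα, hβ] at this
  have horb : ∀ u v, Relation.EqvGen (InvStep α β) u v →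
      ((∃ i : ℤ, u = (τ ^ i) x) ↔ ∃ i : ℤ, v = (τ ^ i) x) := by
    have hA : ∀ p, (∃ i : ℤ, p = (τ ^ i) x) → ∃ i : ℤ, α p = (τ ^ i) x := by
      rintro p ⟨i, rfl⟩; exact ⟨_, hαx i⟩
    have hB : ∀ p, (∃ i : ℤ, p = (τ ^ i) x) → ∃ i : ℤ, β p = (τ ^ i) x := by
      rintro p ⟨i, rfl⟩; exact ⟨_, hβx i⟩
    intro u v h
    induction h with
    | rel u v h =>
      cases h with
      | fst => exact ⟨hA u, fun h => by simpa [hα] using hA _ h⟩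
      | snd => exact ⟨hB u, fun h => by simpa [hβ] using hB _ h⟩
    | refl => exact Iff.rfl
    | symm _ _ _ ih => exact ih.symm
    | trans _ _ _ _ _ ih1 ih2 => exact ih1.trans ih2
  refine ⟨(τ ^ k) x, ⟨?_, ?_, hpow k⟩, ?_⟩
  · rw [Ne, hper]
    rintro ⟨c, hc⟩
    have hkpos : 0 < k := by omega
    have : k * (2 * c - 1) = 0 := by rw [hk] at hc; linarith
    rcases mul_eq_zero.1 this with h | h <;> omega
  · rw [hβx, hper2]
    exact ⟨-1, by omega⟩
  · rintro y ⟨hyx, hby, hy⟩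
    obtain ⟨i, rfl⟩ := (horb _ _ hy).1 ⟨0, by simp⟩
    rw [hβx, hper2] at hby
    obtain ⟨c, hc⟩ := hby
    have hi : i = -(k * c) := by
      rw [hk] at hc
      linarith
    rw [hper2]
    have hodd : ¬ ∃ e, c = 2 * e := by
      rintro ⟨e, rfl⟩
      exact hyx ((hper i).2 ⟨-e, by rw [hi, hk]; ring⟩)
    rcases Int.even_or_odd' c with ⟨e, he | he⟩
    · exact absurd ⟨e, he⟩ hodd
    · exact ⟨-e - 1, by rw [hi, hk, he]; ring⟩

end Dihedral

/-- The dots of the two diagrams before the middle rows are identified, mapped to the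
three-row picture. -/
def glue : (X ⊕ Y) ⊕ (Y ⊕ Z) → X ⊕ (Y ⊕ Z) := Sum.elim upper lower

/-- The identification of the two middle rows as an involution. -/
def swapMiddle : (X ⊕ Y) ⊕ (Y ⊕ Z) → (X ⊕ Y) ⊕ (Y ⊕ Z)
  | .inl (.inl x) => .inl (.inl x)
  | .inl (.inr y) => .inr (.inl y)
  | .inr (.inl y) => .inl (.inr y)
  | .inr (.inr z) => .inr (.inr z)

theorem glue_eq_iff (p q : (X ⊕ Y) ⊕ (Y ⊕ Z)) :
    glue p = glue q ↔ p = q ∨ q = swapMiddle p := by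
  rcases p with (p | p) | (p | p) <;> rcases q with (q | q) | (q | q) <;>
    simp [glue, upper, lower, swapMiddle, eq_comm]

theorem glue_swapMiddle (p : (X ⊕ Y) ⊕ (Y ⊕ Z)) : glue (swapMiddle p) = glue p := by
  rcases p with (p | p) | (p | p) <;> rfl

theorem glue_surjective : Function.Surjective (glue : (X ⊕ Y) ⊕ (Y ⊕ Z) → _) := by
  rintro (x | y | z)
  exacts [⟨.inl (.inl x), rfl⟩, ⟨.inr (.inl y), rfl⟩, ⟨.inr (.inr z), rfl⟩]

theorem stack_glue_iff (a : PerfectMatching (X ⊕ Y)) (b : PerfectMatching (Y ⊕ Z))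
    (p q : (X ⊕ Y) ⊕ (Y ⊕ Z)) :
    stack a b (glue p) (glue q) ↔
      Relation.EqvGen (InvStep (Sum.map a.partner b.partner) swapMiddle) p q := by
  constructor
  · have key : ∀ u v, Relation.EqvGen (StackEdge a b) u v → ∀ p q, glue p = u → glue q = v →
        Relation.EqvGen (InvStep (Sum.map a.partner b.partner) swapMiddle) p q := by
      have h0 : ∀ p q : (X ⊕ Y) ⊕ (Y ⊕ Z), glue p = glue q →
          Relation.EqvGen (InvStep (Sum.map a.partner b.partner) swapMiddle) p q := by
        intro p q h
        rcases (glue_eq_iff p q).1 h with rfl | rfl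
        · exact .refl _
        · exact .rel _ _ (.snd _)
      intro u v h
      induction h with
      | rel u v h =>
        intro p q hp hq
        cases h with
        | upper s =>
          exact .trans _ _ _ (h0 p (.inl s) hp) (.trans _ _ _ (.rel _ _ (.fst _))
            (h0 _ q hq.symm))
        | lower s =>
          exact .trans _ _ _ (h0 p (.inr s) hp) (.trans _ _ _ (.rel _ _ (.fst _))
            (h0 _ q hq.symm))
      | refl u => intro p q hp hq; exact h0 p q (hp.trans hq.symm)
      | symm _ _ _ ih => intro p q hp hq; exact .symm _ _ (ih q p hq hp)
      | trans _ v _ _ _ ih1 ih2 =>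
        intro p q hp hq
        obtain ⟨s, hs⟩ := glue_surjective v
        exact .trans _ _ _ (ih1 p s hp hs) (ih2 s q hs hq)
    exact fun h => key _ _ h p q rfl rfl
  · intro h
    induction h with
    | rel p q h =>
      cases h with
      | fst =>
        rcases p with p | p
        · exact .rel _ _ (.upper p)
        · exact .rel _ _ (.lower p)
      | snd => rw [glue_swapMiddle]
    | refl => exact .refl _
    | symm _ _ _ ih => exact .symm _ _ ih
    | trans _ _ _ _ _ ih1 ih2 => exact .trans _ _ _ ih1 ih2

theorem existsUnique_outer [Finite X] [Finite Y] [Finite Z]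
    (a : PerfectMatching (X ⊕ Y)) (b : PerfectMatching (Y ⊕ Z)) (e : X ⊕ Z) :
    ∃! e', e' ≠ e ∧ stack a b (outer e) (outer e') := by
  let lift : X ⊕ Z → (X ⊕ Y) ⊕ (Y ⊕ Z) := Sum.map Sum.inl Sum.inr
  have hl : ∀ e, glue (lift e) = outer e := by rintro (x | z) <;> rfl
  have hfix : ∀ p, swapMiddle p = p ↔ ∃ e, p = lift e := by
    rintro ((x | y) | (y | z)) <;> simp [swapMiddle, lift]
  have hinj : Function.Injective lift := by
    rintro (x | z) (x' | z') h <;> simp_all [lift]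
  obtain ⟨y, ⟨h1, h2, h3⟩, h4⟩ := existsUnique_other_end (Sum.map a.partner b.partner)
    swapMiddle
    (by rintro (p | p) <;> simp [a.partner_partner, b.partner_partner])
    (by rintro ((x | y) | (y | z)) <;> rfl)
    (by rintro (p | p) <;> simp [a.partner_ne, b.partner_ne])
    (lift e) ((hfix _).2 ⟨e, rfl⟩)
  obtain ⟨e', rfl⟩ := (hfix _).1 h2
  refine ⟨e', ⟨fun h => h1 (h ▸ rfl), ?_⟩, ?_⟩
  · rw [← hl, ← hl]
    exact (stack_glue_iff a b _ _).2 h3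
  · rintro e'' ⟨g1, g2⟩
    rw [← hl, ← hl] at g2
    exact hinj (h4 _ ⟨fun h => g1 (hinj h), (hfix _).2 ⟨e'', rfl⟩, (stack_glue_iff a b _ _).1 g2⟩)

/-- The concatenation of `a` (on top) and `b` (below), loops deleted: the partner of an outer
dot is the other outer dot in its connected component of the three-row picture. -/
noncomputable def comp [Finite X] [Finite Y] [Finite Z]
    (a : PerfectMatching (X ⊕ Y)) (b : PerfectMatching (Y ⊕ Z)) : PerfectMatching (X ⊕ Z) where
  partner e := (existsUnique_outer a b e).choose
  partner_partner e := by
    have h := (existsUnique_outer a b e).choose_spec.1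
    exact ((existsUnique_outer a b _).choose_spec.2 e ⟨h.1.symm, .symm _ _ h.2⟩).symm
  partner_ne e := (existsUnique_outer a b e).choose_spec.1.1

section Comp

variable [Finite W] [Finite X] [Finite Y] [Finite Z]

theorem stack_comp_partner (a : PerfectMatching (X ⊕ Y)) (b : PerfectMatching (Y ⊕ Z))
    (e : X ⊕ Z) : stack a b (outer e) (outer ((comp a b).partner e)) :=
  (existsUnique_outer a b e).choose_spec.1.2

theorem stack_outer_iff (a : PerfectMatching (X ⊕ Y)) (b : PerfectMatching (Y ⊕ Z))
    (e e' : X ⊕ Z) :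
    stack a b (outer e) (outer e') ↔ e' = e ∨ e' = (comp a b).partner e := by
  constructor
  · intro h
    by_cases he : e' = e
    · exact .inl he
    · exact .inr ((existsUnique_outer a b e).choose_spec.2 e' ⟨he, h⟩)
  · rintro (rfl | rfl)
    · exact .refl _
    · exact stack_comp_partner a b e

theorem eq_comp_partner_iff (a : PerfectMatching (X ⊕ Y)) (b : PerfectMatching (Y ⊕ Z))
    (e e' : X ⊕ Z) :
    e' = (comp a b).partner e ↔ e' ≠ e ∧ stack a b (outer e) (outer e') := by
  rw [stack_outer_iff]
  constructor
  · intro h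
    exact ⟨h ▸ (comp a b).partner_ne e, .inr h⟩
  · rintro ⟨h1, h2 | h2⟩
    exacts [absurd h2 h1, h2]

end Comp

theorem stack_le {a : PerfectMatching (X ⊕ Y)} {b : PerfectMatching (Y ⊕ Z)}
    {T : Setoid (X ⊕ (Y ⊕ Z))} (ha : ∀ p, T (upper p) (upper (a.partner p)))
    (hb : ∀ p, T (lower p) (lower (b.partner p))) : stack a b ≤ T := by
  refine Setoid.eqvGen_le ?_
  rintro _ _ (p | p)
  exacts [ha p, hb p]

/-! ### Associativity of concatenation -/

section Eliminate

/-- Eliminating the part `A` of a glued graph on `V` that is covered by `A` and `B` with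
overlap `E`. -/
theorem eliminate {V A B E O : Type*} [Finite A] [Finite B]
    {i : A → V} {j : B → V} {o : E → A} {k : E → B}
    (hi : Function.Injective i) (hj : Function.Injective j)
    (hcov : ∀ v, (∃ a, v = i a) ∨ ∃ b, v = j b)
    (hok : ∀ e, i (o e) = j (k e))
    (hov : ∀ a b, i a = j b → ∃ e, a = o e ∧ b = k e)
    {T : Setoid V} {SA : Setoid A} {SB : Setoid B} {R : B → B → Prop}
    (hTA : ∀ a a', SA a a' → T (i a) (i a')) (hTR : ∀ b b', R b b' → T (j b) (j b'))
    (hT : ∀ T' : Setoid V, (∀ a a', SA a a' → T' (i a) (i a')) →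
      (∀ b b', R b b' → T' (j b) (j b')) → T ≤ T')
    (hSE : ∀ e e', SA (o e) (o e') → SB (k e) (k e')) (hSR : ∀ b b', R b b' → SB b b')
    (hS : ∀ S' : Setoid B, (∀ e e', SA (o e) (o e') → S' (k e) (k e')) →
      (∀ b b', R b b' → S' b b') → SB ≤ S')
    (out : O → B) :
    (∀ b b', T (j b) (j b') ↔ SB b b') ∧
    Nat.card {c : Quotient T // ∀ x, Quotient.mk T (j (out x)) ≠ c} =
      Nat.card {c : Quotient SA // ∀ e, Quotient.mk SA (o e) ≠ c} +
      Nat.card {c : Quotient SB // ∀ x, Quotient.mk SB (out x) ≠ c} := by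
  have h1 : ∀ b b', T (j b) (j b') ↔ SB b b' := by
    intro b b'
    constructor
    · let color : V → Set (Quotient SB) := fun v =>
        {q | (∃ e a, v = i a ∧ SA a (o e) ∧ q = Quotient.mk SB (k e)) ∨
          ∃ b, v = j b ∧ q = Quotient.mk SB b}
      have hcj : ∀ b, color (j b) = {Quotient.mk SB b} := by
        intro b
        ext q
        simp only [color, Set.mem_ofPred_eq, Set.mem_singleton_iff]
        constructor
        · rintro (⟨e, a, h, hs, rfl⟩ | ⟨b', h, rfl⟩)
          · obtain ⟨e', rfl, rfl⟩ := hov a b h.symm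
            exact Quotient.sound (hSE _ _ (SA.symm hs))
          · rw [hj h]
        · rintro rfl
          exact .inr ⟨b, rfl, rfl⟩
      have hle : T ≤ Setoid.ker color := by
        refine hT _ ?_ ?_
        · have key : ∀ a a', SA a a' → color (i a) ⊆ color (i a') := by
            rintro a a' h q (⟨e, a'', h', hs, rfl⟩ | ⟨b, h', rfl⟩)
            · obtain rfl := hi h'
              exact .inl ⟨e, a', rfl, SA.trans (SA.symm h) hs, rfl⟩
            · obtain ⟨e, rfl, rfl⟩ := hov a b h'
              exact .inl ⟨e, a', rfl, SA.symm h, rfl⟩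
          exact fun a a' h => Set.Subset.antisymm (key _ _ h) (key _ _ (SA.symm h))
        · intro b b' h
          change color (j b) = color (j b')
          rw [hcj, hcj, Quotient.sound (hSR _ _ h)]
      intro h
      have h' : color (j b) = color (j b') := hle h
      rw [hcj, hcj, Set.singleton_eq_singleton_iff] at h'
      exact Quotient.exact h'
    · intro h
      have hle : SB ≤ T.comap j := by
        refine hS _ ?_ ?_
        · intro e e' h
          change T (j (k e)) (j (k e'))
          rw [← hok, ← hok]
          exact hTA _ _ h
        · exact hTR
      exact hle h
  have h2 : ∀ a, (∀ e, ¬ SA a (o e)) → ∀ v, T (i a) v → ∃ a', v = i a' ∧ SA a a' := by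
    intro a ha v hv
    have hle : T ≤ Setoid.ker (fun v => ∃ a', v = i a' ∧ SA a a') := by
      refine hT _ ?_ ?_
      · intro a1 a2 h
        refine propext ⟨?_, ?_⟩
        · rintro ⟨a', h', hs⟩
          obtain rfl := hi h'
          exact ⟨a2, rfl, SA.trans hs h⟩
        · rintro ⟨a', h', hs⟩
          obtain rfl := hi h'
          exact ⟨a1, rfl, SA.trans hs (SA.symm h)⟩
      · have key : ∀ b, ¬ ∃ a', j b = i a' ∧ SA a a' := by
          rintro b ⟨a', h', hs⟩
          obtain ⟨e, rfl, -⟩ := hov a' b h'.symm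
          exact ha e hs
        exact fun b b' _ => propext ⟨fun h => absurd h (key b), fun h => absurd h (key b')⟩
    have : (∃ a', i a = i a' ∧ SA a a') = ∃ a', v = i a' ∧ SA a a' := hle hv
    rw [← this]
    exact ⟨a, rfl, SA.refl a⟩
  refine ⟨h1, ?_⟩
  rw [← Nat.card_sum]
  symm
  have h3 : ∀ a, (∀ e, ¬ SA a (o e)) → ∀ b, ¬ T (i a) (j b) := by
    intro a ha b hb
    obtain ⟨a', h, hs⟩ := h2 a ha _ hb
    obtain ⟨e, rfl, -⟩ := hov a' b h.symm
    exact ha e hs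
  let fA : Quotient SA → Quotient T := Quotient.map i hTA
  let fB : Quotient SB → Quotient T := Quotient.map j fun b b' h => (h1 b b').2 h
  have hA : ∀ c : Quotient SA, (∀ e, Quotient.mk SA (o e) ≠ c) →
      ∀ b, Quotient.mk T (j b) ≠ fA c := by
    intro c
    induction c using Quotient.inductionOn with
    | h a =>
      intro hc b hb
      exact h3 a (fun e h => hc e (Quotient.sound (SA.symm h))) b (T.symm (Quotient.exact hb))
  have hB : ∀ c : Quotient SB, (∀ x, Quotient.mk SB (out x) ≠ c) →
      ∀ x, Quotient.mk T (j (out x)) ≠ fB c := by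
    intro c
    induction c using Quotient.inductionOn with
    | h b =>
      intro hc x hx
      exact hc x (Quotient.sound ((h1 _ _).1 (Quotient.exact hx)))
  refine Nat.card_eq_of_bijective
    (Sum.elim (fun c => ⟨fA c.1, fun x => hA c.1 c.2 (out x)⟩) fun c => ⟨fB c.1, hB c.1 c.2⟩)
    ⟨?_, ?_⟩
  · rintro (⟨c, hc⟩ | ⟨c, hc⟩) (⟨c', hc'⟩ | ⟨c', hc'⟩) h
    · have h' : fA c = fA c' := congrArg Subtype.val h
      clear h
      induction c using Quotient.inductionOn with
      | h a =>
        induction c' using Quotient.inductionOn with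
        | h a' =>
          obtain ⟨a'', g1, g2⟩ := h2 a (fun e h => hc e (Quotient.sound (SA.symm h))) _
            (Quotient.exact h')
          obtain rfl := hi g1
          exact congrArg Sum.inl (Subtype.ext (Quotient.sound g2))
    · have h' : fA c = fB c' := congrArg Subtype.val h
      clear h
      induction c' using Quotient.inductionOn with
      | h b => exact absurd h'.symm (hA c hc b)
    · have h' : fB c = fA c' := congrArg Subtype.val h
      clear h
      induction c using Quotient.inductionOn with
      | h b => exact absurd h' (hA c' hc' b)
    · have h' : fB c = fB c' := congrArg Subtype.val h
      clear h
      induction c using Quotient.inductionOn with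
      | h b =>
        induction c' using Quotient.inductionOn with
        | h b' =>
          exact congrArg Sum.inr (Subtype.ext (Quotient.sound ((h1 _ _).1 (Quotient.exact h'))))
  · rintro ⟨c, hc⟩
    by_cases hb : ∃ b, Quotient.mk T (j b) = c
    · obtain ⟨b, rfl⟩ := hb
      exact ⟨.inr ⟨Quotient.mk SB b, fun x hx => hc x
        (Quotient.sound ((h1 _ _).2 (Quotient.exact hx)))⟩, rfl⟩
    · induction c using Quotient.inductionOn with
      | h v =>
        rcases hcov v with ⟨a, rfl⟩ | ⟨b, rfl⟩
        · refine ⟨.inl ⟨Quotient.mk SA a, fun e he => hb ⟨k e, ?_⟩⟩, rfl⟩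
          rw [← hok]
          exact Quotient.sound (hTA _ _ (Quotient.exact he))
        · exact absurd ⟨b, rfl⟩ hb

end Eliminate

section Assoc

theorem outer_four (e : W ⊕ Z) :
    (Sum.map id Sum.inr (outer e : W ⊕ (Y ⊕ Z)) : W ⊕ (X ⊕ (Y ⊕ Z))) =
      Sum.map id (Sum.map id Sum.inr) (outer e : W ⊕ (X ⊕ Z)) := by
  rcases e with e | e <;> rfl

variable [Finite W] [Finite X] [Finite Y] [Finite Z]

/-- The edges of the four-row picture of three stacked diagrams. -/
inductive StackEdge₃ (a : PerfectMatching (W ⊕ X)) (b : PerfectMatching (X ⊕ Y))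
    (c : PerfectMatching (Y ⊕ Z)) : W ⊕ (X ⊕ (Y ⊕ Z)) → W ⊕ (X ⊕ (Y ⊕ Z)) → Prop
  | top (p : W ⊕ X) : StackEdge₃ a b c (upper p) (upper (a.partner p))
  | mid (p : X ⊕ Y) : StackEdge₃ a b c (.inr (upper p)) (.inr (upper (b.partner p)))
  | bot (p : Y ⊕ Z) : StackEdge₃ a b c (.inr (lower p)) (.inr (lower (c.partner p)))

theorem assoc_left (a : PerfectMatching (W ⊕ X)) (b : PerfectMatching (X ⊕ Y))
    (c : PerfectMatching (Y ⊕ Z)) :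
    (∀ u v, Relation.EqvGen.setoid (StackEdge₃ a b c) (Sum.map id Sum.inr u)
        (Sum.map id Sum.inr v) ↔ stack (comp a b) c u v) ∧
    Nat.card {q : Quotient (Relation.EqvGen.setoid (StackEdge₃ a b c)) //
      ∀ x : W ⊕ Z, Quotient.mk _ (Sum.map id Sum.inr (outer x : W ⊕ (Y ⊕ Z))) ≠ q} =
      loops a b + loops (comp a b) c := by
  have hup : ∀ p : W ⊕ X, (upper p : W ⊕ (X ⊕ (Y ⊕ Z))) =
      Sum.map id (Sum.map id Sum.inl) (upper p : W ⊕ (X ⊕ Y)) := by rintro (p | p) <;> rfl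
  have hmid : ∀ p : X ⊕ Y, (.inr (upper p) : W ⊕ (X ⊕ (Y ⊕ Z))) =
      Sum.map id (Sum.map id Sum.inl) (lower p : W ⊕ (X ⊕ Y)) := by rintro (p | p) <;> rfl
  refine eliminate (A := W ⊕ (X ⊕ Y)) (E := W ⊕ Y) (i := Sum.map id (Sum.map id Sum.inl))
    (o := outer) (k := upper) (SA := stack a b)
    (R := fun u v => ∃ p, u = lower p ∧ v = lower (c.partner p)) ?_ ?_ ?_ ?_ ?_ ?_ ?_ ?_ ?_ ?_ ?_
    outer
  · rintro (u | u | u) (v | v | v) h <;> simp_all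
  · rintro (u | u | u) (v | v | v) h <;> simp_all
  · rintro (v | v | v | v)
    · exact .inl ⟨.inl v, rfl⟩
    · exact .inl ⟨.inr (.inl v), rfl⟩
    · exact .inl ⟨.inr (.inr v), rfl⟩
    · exact .inr ⟨.inr (.inr v), rfl⟩
  · rintro (e | e) <;> rfl
  · rintro (u | u | u) (v | v | v) h <;> simp at h
    · exact ⟨.inl u, rfl, by simp [upper, h]⟩
    · exact ⟨.inr u, rfl, by simp [upper, h]⟩
  · intro u v h
    have hle : stack a b ≤ (Relation.EqvGen.setoid (StackEdge₃ a b c)).comap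
        (Sum.map id (Sum.map id Sum.inl)) := by
      refine stack_le (fun p => ?_) (fun p => ?_)
      · have := StackEdge₃.top (b := b) (c := c) (a := a) p
        rw [hup, hup] at this
        exact .rel _ _ this
      · have := StackEdge₃.mid (b := b) (c := c) (a := a) p
        rw [hmid, hmid] at this
        exact .rel _ _ this
    exact hle h
  · rintro _ _ ⟨p, rfl, rfl⟩
    exact .rel _ _ (.bot p)
  · intro T' h1 h2
    refine Setoid.eqvGen_le ?_
    rintro _ _ (p | p | p)
    · rw [hup, hup]
      exact h1 _ _ (.rel _ _ (.upper p))
    · rw [hmid, hmid]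
      exact h1 _ _ (.rel _ _ (.lower p))
    · exact h2 _ _ ⟨p, rfl, rfl⟩
  · intro e e' h
    rcases (stack_outer_iff a b e e').1 h with rfl | rfl
    · exact .refl _
    · exact .rel _ _ (.upper e)
  · rintro _ _ ⟨p, rfl, rfl⟩
    exact .rel _ _ (.lower p)
  · intro S' h1 h2
    exact stack_le (fun p => h1 _ _ (stack_comp_partner a b p)) fun p => h2 _ _ ⟨p, rfl, rfl⟩

theorem assoc_right (a : PerfectMatching (W ⊕ X)) (b : PerfectMatching (X ⊕ Y))
    (c : PerfectMatching (Y ⊕ Z)) :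
    (∀ u v, Relation.EqvGen.setoid (StackEdge₃ a b c) (Sum.map id (Sum.map id Sum.inr) u)
        (Sum.map id (Sum.map id Sum.inr) v) ↔ stack a (comp b c) u v) ∧
    Nat.card {q : Quotient (Relation.EqvGen.setoid (StackEdge₃ a b c)) //
      ∀ x : W ⊕ Z, Quotient.mk _ (Sum.map id (Sum.map id Sum.inr)
        (outer x : W ⊕ (X ⊕ Z))) ≠ q} =
      loops b c + loops a (comp b c) := by
  have hup : ∀ p : W ⊕ X, (upper p : W ⊕ (X ⊕ (Y ⊕ Z))) =
      Sum.map id (Sum.map id Sum.inr) (upper p : W ⊕ (X ⊕ Z)) := by rintro (p | p) <;> rfl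
  refine eliminate (A := X ⊕ (Y ⊕ Z)) (E := X ⊕ Z) (i := Sum.inr)
    (o := outer) (k := lower) (SA := stack b c)
    (R := fun u v => ∃ p, u = upper p ∧ v = upper (a.partner p)) ?_ ?_ ?_ ?_ ?_ ?_ ?_ ?_ ?_ ?_ ?_
    outer
  · exact Sum.inr_injective
  · rintro (u | u | u) (v | v | v) h <;> simp_all
  · rintro (v | v)
    · exact .inr ⟨.inl v, rfl⟩
    · exact .inl ⟨v, rfl⟩
  · rintro (e | e) <;> rfl
  · rintro (u | u | u) (v | v | v) h <;> simp at h
    · exact ⟨.inl u, rfl, by simp [lower, h]⟩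
    · exact ⟨.inr u, rfl, by simp [lower, h]⟩
  · intro u v h
    have hle : stack b c ≤ (Relation.EqvGen.setoid (StackEdge₃ a b c)).comap Sum.inr :=
      stack_le (fun p => .rel _ _ (.mid p)) (fun p => .rel _ _ (.bot p))
    exact hle h
  · rintro _ _ ⟨p, rfl, rfl⟩
    rw [← hup, ← hup]
    exact .rel _ _ (.top p)
  · intro T' h1 h2
    refine Setoid.eqvGen_le ?_
    rintro _ _ (p | p | p)
    · rw [hup, hup]
      exact h2 _ _ ⟨p, rfl, rfl⟩
    · exact h1 _ _ (.rel _ _ (.upper p))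
    · exact h1 _ _ (.rel _ _ (.lower p))
  · intro e e' h
    rcases (stack_outer_iff b c e e').1 h with rfl | rfl
    · exact .refl _
    · exact .rel _ _ (.lower e)
  · rintro _ _ ⟨p, rfl, rfl⟩
    exact .rel _ _ (.upper p)
  · intro S' h1 h2
    exact stack_le (fun p => h2 _ _ ⟨p, rfl, rfl⟩) fun p => h1 _ _ (stack_comp_partner b c p)

theorem comp_assoc (a : PerfectMatching (W ⊕ X)) (b : PerfectMatching (X ⊕ Y))
    (c : PerfectMatching (Y ⊕ Z)) : comp (comp a b) c = comp a (comp b c) := by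
  ext e : 2
  rw [eq_comp_partner_iff, ← (assoc_right a b c).1, ← outer_four, ← outer_four,
    (assoc_left a b c).1, ← eq_comp_partner_iff]

theorem loops_assoc (a : PerfectMatching (W ⊕ X)) (b : PerfectMatching (X ⊕ Y))
    (c : PerfectMatching (Y ⊕ Z)) :
    loops a b + loops (comp a b) c = loops b c + loops a (comp b c) := by
  rw [← (assoc_left a b c).2, ← (assoc_right a b c).2]
  simp only [outer_four]

end Assoc

/-! ### The identity diagram -/

/-- The diagram all of whose edges are vertical. -/
def one (X : Type*) : PerfectMatching (X ⊕ X) where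
  partner := Sum.swap
  partner_partner := Sum.swap_swap
  partner_ne := by rintro (x | x) <;> simp

/-- The equivalence relation whose classes are the edges of the matching. -/
def pairs (m : PerfectMatching X) : Setoid X where
  r u v := v = u ∨ v = m.partner u
  iseqv := ⟨fun _ => .inl rfl, by
    rintro u v (rfl | rfl)
    exacts [.inl rfl, .inr (m.partner_partner u).symm], by
    rintro u v w (rfl | rfl) (rfl | rfl)
    exacts [.inl rfl, .inr rfl, .inr rfl, .inl (m.partner_partner u)]⟩

section One

variable [Finite X] [Finite Y]

theorem one_comp (b : PerfectMatching (X ⊕ Y)) : comp (one X) b = b := by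
  have hle : stack (one X) b ≤ (pairs b).comap (Sum.elim Sum.inl id) := by
    refine stack_le (fun p => ?_) (fun p => .inr rfl)
    rcases p with p | p <;> exact .inl rfl
  have ho : ∀ e : X ⊕ Y, Sum.elim Sum.inl id (outer e : X ⊕ (X ⊕ Y)) = e := by
    rintro (e | e) <;> rfl
  ext e : 2
  have h : _ = _ ∨ _ = _ := hle (stack_comp_partner (one X) b e)
  rw [ho, ho] at h
  exact h.resolve_left ((comp (one X) b).partner_ne e)

theorem comp_one (a : PerfectMatching (X ⊕ Y)) : comp a (one Y) = a := by
  have hle : stack a (one Y) ≤ (pairs a).comap (Sum.map id (Sum.elim id id)) := by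
    refine stack_le (fun p => ?_) (fun p => ?_)
    · have hu : ∀ p : X ⊕ Y, Sum.map id (Sum.elim id id) (upper p : X ⊕ (Y ⊕ Y)) = p := by
        rintro (e | e) <;> rfl
      refine .inr ?_
      rw [hu, hu]
    · rcases p with p | p <;> exact .inl rfl
  have ho : ∀ e : X ⊕ Y, Sum.map id (Sum.elim id id) (outer e : X ⊕ (Y ⊕ Y)) = e := by
    rintro (e | e) <;> rfl
  ext e : 2
  have h : _ = _ ∨ _ = _ := hle (stack_comp_partner a (one Y) e)
  rw [ho, ho] at h
  exact h.resolve_left ((comp a (one Y)).partner_ne e)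

end One

theorem loops_eq_zero {a : PerfectMatching (X ⊕ Y)}
    {b : PerfectMatching (Y ⊕ Z)}
    (h : ∀ y : Y, ∃ e, stack a b (outer e) (.inr (.inl y))) : loops a b = 0 := by
  rw [loops, Nat.card_eq_zero]
  refine .inl ⟨?_⟩
  rintro ⟨c, hc⟩
  induction c using Quotient.inductionOn with
  | h v =>
    rcases v with x | y | z
    · exact hc (.inl x) rfl
    · obtain ⟨e, he⟩ := h y
      exact hc e (Quotient.sound he)
    · exact hc (.inr z) rfl

theorem loops_one_left (b : PerfectMatching (X ⊕ Y)) : loops (one X) b = 0 :=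
  loops_eq_zero fun y => ⟨.inl y, .rel _ _ (.upper (.inl y))⟩

theorem loops_one_right (a : PerfectMatching (X ⊕ Y)) : loops a (one Y) = 0 :=
  loops_eq_zero fun y => ⟨.inr y, .rel _ _ (.lower (.inr y))⟩

/-! ### The cycle type -/

section CycleType

/-- The contribution of an edge traversed from `p` to `q`: `1` if it points downward, `-1` if it
points upward, `0` if it is horizontal. The top row is `Sum.inl`, the bottom row `Sum.inr`. -/
def direction : X ⊕ X → X ⊕ X → ℤ
  | .inl _, .inr _ => 1
  | .inr _, .inl _ => -1
  | _, _ => 0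

/-- The edges of the graph obtained from a diagram by connecting each dot of the top row with
the dot below it. -/
inductive ClosureEdge (d : PerfectMatching (X ⊕ X)) : X ⊕ X → X ⊕ X → Prop
  | arc (p : X ⊕ X) : ClosureEdge d p (d.partner p)
  | column (p : X ⊕ X) : ClosureEdge d p p.swap

/-- Two dots are related if they lie in the same connected component of that graph. -/
def closure (d : PerfectMatching (X ⊕ X)) : Setoid (X ⊕ X) :=
  Relation.EqvGen.setoid (ClosureEdge d)

/-- Following the path through `p` that starts with the original edge at `p`: traverse this edge
and then the added edge of the column that has been reached. The next original edge is
traversed starting from `walk d p`. -/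
def walk (d : PerfectMatching (X ⊕ X)) : Equiv.Perm (X ⊕ X) where
  toFun p := (d.partner p).swap
  invFun p := d.partner p.swap
  left_inv p := by simp [d.partner_partner]
  right_inv p := by simp [d.partner_partner]

open Classical in
/-- The number of downward minus the number of upward pointing edges when the component of `p` is
traversed once, starting at `p` along the original edge at `p`. -/
noncomputable def netDown [Fintype X] (d : PerfectMatching (X ⊕ X)) (p : X ⊕ X) : ℤ :=
  ∑ q with (walk d).SameCycle p q, direction q (d.partner q)

theorem netDown_partner [Fintype X] (d : PerfectMatching (X ⊕ X)) (p : X ⊕ X) :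
    netDown d (d.partner p) = - netDown d p := by
  classical
  have hw : ∀ q, d.partner (walk d q) = (walk d)⁻¹ (d.partner q) := fun q => rfl
  have hw' : ∀ q, d.partner ((walk d)⁻¹ q) = walk d (d.partner q) := fun q => by
    change d.partner (d.partner q.swap) = (d.partner (d.partner q)).swap
    rw [d.partner_partner, d.partner_partner]
  have hz : ∀ (i : ℤ) (q), d.partner ((walk d ^ i) q) = (walk d ^ (-i)) (d.partner q) := by
    intro i
    induction i using Int.induction_on with
    | zero => intro q; simp
    | succ n ih =>
      intro q
      rw [add_comm, zpow_add, zpow_one, Equiv.Perm.mul_apply, hw, ih, neg_add, zpow_add,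
        zpow_neg_one, Equiv.Perm.mul_apply]
    | pred n ih =>
      intro q
      rw [sub_eq_neg_add, zpow_add, zpow_neg_one, Equiv.Perm.mul_apply, hw', ih,
        neg_add, neg_neg, neg_neg, zpow_add, zpow_one, Equiv.Perm.mul_apply]
  have hs : ∀ p q, (walk d).SameCycle p q → (walk d).SameCycle (d.partner p) (d.partner q) := by
    rintro p q ⟨i, rfl⟩
    exact ⟨-i, (hz i p).symm⟩
  have hdir : ∀ p q : X ⊕ X, direction q p = - direction p q := by
    rintro (p | p) (q | q) <;> rfl
  rw [netDown, netDown, ← Finset.sum_neg_distrib]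
  refine Finset.sum_bij' (fun q _ => d.partner q) (fun q _ => d.partner q) ?_ ?_ ?_ ?_ ?_
  · intro q hq
    rw [Finset.mem_filter] at hq ⊢
    have := hs _ _ hq.2
    rw [d.partner_partner] at this
    exact ⟨Finset.mem_univ _, this⟩
  · intro q hq
    rw [Finset.mem_filter] at hq ⊢
    exact ⟨Finset.mem_univ _, hs _ _ hq.2⟩
  · intro q _
    exact d.partner_partner q
  · intro q _
    exact d.partner_partner q
  · intro q _
    rw [d.partner_partner, hdir]

theorem netDown_walk [Fintype X] (d : PerfectMatching (X ⊕ X)) (p : X ⊕ X) :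
    netDown d (walk d p) = netDown d p := by
  classical
  refine Finset.sum_congr (Finset.filter_congr fun q _ => ?_) fun _ _ => rfl
  exact Equiv.Perm.sameCycle_apply_left

theorem natAbs_netDown_eq [Fintype X] (d : PerfectMatching (X ⊕ X)) (p q : X ⊕ X)
    (h : closure d p q) : (netDown d p).natAbs = (netDown d q).natAbs := by
  have hle : closure d ≤ Setoid.ker fun p => (netDown d p).natAbs := by
    refine Setoid.eqvGen_le ?_
    rintro p _ (_ | _)
    · change (netDown d p).natAbs = (netDown d (d.partner p)).natAbs
      rw [netDown_partner, Int.natAbs_neg]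
    · change (netDown d p).natAbs = (netDown d p.swap).natAbs
      have : p.swap = walk d (d.partner p) := by simp [walk, d.partner_partner]
      rw [this, netDown_walk, netDown_partner, Int.natAbs_neg]
  exact hle h

/-- The number attached to a connected component: the absolute value of the difference between
the numbers of downward and of upward pointing edges. -/
noncomputable def componentNumber [Fintype X] (d : PerfectMatching (X ⊕ X)) :
    Quotient (closure d) → ℕ :=
  Quotient.lift (fun p => (netDown d p).natAbs) (natAbs_netDown_eq d)

open Classical in
/-- The cycle type: the multiset of the numbers of all connected components, zeros included. -/
noncomputable def cycleType [Fintype X] (d : PerfectMatching (X ⊕ X)) : Multiset ℕ :=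
  letI : Fintype (Quotient (closure d)) := Fintype.ofFinite _
  (Finset.univ : Finset (Quotient (closure d))).val.map (componentNumber d)

end CycleType

end PerfectMatching

/-! ### The Brauer algebra -/

/-- Diagrams on `2r` dots: the top row is `Sum.inl`, the bottom row is `Sum.inr`. -/
abbrev BrauerDiagram (r : ℕ) : Type := PerfectMatching (Fin r ⊕ Fin r)

/-- The Brauer algebra with parameter `δ`: the free module on the diagrams on `2r` dots, with
multiplication given by concatenation. -/
def BrauerAlgebra (F : Type*) [CommRing F] (r : ℕ) (_δ : F) : Type _ := BrauerDiagram r →₀ F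

namespace BrauerAlgebra

open PerfectMatching

variable {F : Type*} [CommRing F] {r : ℕ} {δ : F}

noncomputable instance : AddCommGroup (BrauerAlgebra F r δ) :=
  inferInstanceAs (AddCommGroup (BrauerDiagram r →₀ F))

noncomputable instance : Module F (BrauerAlgebra F r δ) :=
  inferInstanceAs (Module F (BrauerDiagram r →₀ F))

variable (F r δ) in
/-- The diagrams form a basis of the Brauer algebra. -/
noncomputable def basis : Module.Basis (BrauerDiagram r) F (BrauerAlgebra F r δ) :=
  .ofRepr (LinearEquiv.refl F (BrauerDiagram r →₀ F))

/-- The bilinear extension of concatenation: a product of diagrams is their concatenation,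
multiplied by as many powers of `δ` as there are loops removed. -/
noncomputable def mulHom :
    BrauerAlgebra F r δ →ₗ[F] BrauerAlgebra F r δ →ₗ[F] BrauerAlgebra F r δ :=
  (basis F r δ).constr F fun a => (basis F r δ).constr F fun b =>
    δ ^ loops a b • basis F r δ (comp a b)

noncomputable instance : Mul (BrauerAlgebra F r δ) := ⟨fun x y => mulHom x y⟩

noncomputable instance : One (BrauerAlgebra F r δ) := ⟨basis F r δ (one (Fin r))⟩

theorem mul_def (x y : BrauerAlgebra F r δ) : x * y = mulHom x y := rfl

theorem one_def : (1 : BrauerAlgebra F r δ) = basis F r δ (one (Fin r)) := rfl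

theorem basis_mul_basis (a b : BrauerDiagram r) :
    basis F r δ a * basis F r δ b = δ ^ loops a b • basis F r δ (comp a b) := by
  rw [mul_def, mulHom, Module.Basis.constr_basis, Module.Basis.constr_basis]

theorem smul_mul' (s : F) (x y : BrauerAlgebra F r δ) : s • x * y = s • (x * y) := by
  simp only [mul_def, map_smul, LinearMap.smul_apply]

theorem mul_smul' (s : F) (x y : BrauerAlgebra F r δ) : x * s • y = s • (x * y) := by
  simp only [mul_def, map_smul]

theorem one_mul' (x : BrauerAlgebra F r δ) : 1 * x = x := by
  have h : mulHom (1 : BrauerAlgebra F r δ) = LinearMap.id := by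
    refine (basis F r δ).ext fun a => ?_
    rw [← mul_def, one_def, basis_mul_basis, loops_one_left, one_comp, pow_zero, one_smul,
      LinearMap.id_apply]
  rw [mul_def, h, LinearMap.id_apply]

theorem mul_one' (x : BrauerAlgebra F r δ) : x * 1 = x := by
  have h : mulHom.flip (1 : BrauerAlgebra F r δ) = LinearMap.id := by
    refine (basis F r δ).ext fun a => ?_
    rw [LinearMap.flip_apply, ← mul_def, one_def, basis_mul_basis, loops_one_right, comp_one,
      pow_zero, one_smul, LinearMap.id_apply]
  rw [mul_def, ← LinearMap.flip_apply, h, LinearMap.id_apply]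

theorem add_mul' (x y z : BrauerAlgebra F r δ) : (x + y) * z = x * z + y * z := by
  simp only [mul_def, map_add, LinearMap.add_apply]

theorem mul_add' (x y z : BrauerAlgebra F r δ) : x * (y + z) = x * y + x * z := by
  simp only [mul_def, map_add]

theorem zero_mul' (x : BrauerAlgebra F r δ) : 0 * x = 0 := by
  simp only [mul_def, map_zero, LinearMap.zero_apply]

theorem mul_zero' (x : BrauerAlgebra F r δ) : x * 0 = 0 := by
  simp only [mul_def, map_zero]

theorem induction_basis {p : BrauerAlgebra F r δ → Prop} (x : BrauerAlgebra F r δ)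
    (basis_mem : ∀ a, p (basis F r δ a)) (zero : p 0) (add : ∀ x y, p x → p y → p (x + y))
    (smul : ∀ (s : F) x, p x → p (s • x)) : p x := by
  refine Submodule.span_induction (p := fun x _ => p x) ?_ zero (fun x y _ _ => add x y)
    (fun s x _ => smul s x) ((basis F r δ).mem_span x)
  rintro _ ⟨a, rfl⟩
  exact basis_mem a

theorem mul_assoc' (x y z : BrauerAlgebra F r δ) : x * y * z = x * (y * z) := by
  induction x using induction_basis with
  | zero => simp only [zero_mul']
  | add x x' h h' => simp only [add_mul', h, h']
  | smul s x h => simp only [smul_mul', h]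
  | basis_mem a =>
    induction y using induction_basis with
    | zero => simp only [zero_mul', mul_zero']
    | add y y' h h' => simp only [add_mul', mul_add', h, h']
    | smul s y h => simp only [smul_mul', mul_smul', h]
    | basis_mem b =>
      induction z using induction_basis with
      | zero => simp only [mul_zero']
      | add z z' h h' => simp only [mul_add', h, h']
      | smul s z h => simp only [mul_smul', h]
      | basis_mem c =>
        rw [basis_mul_basis, basis_mul_basis, smul_mul', mul_smul', basis_mul_basis,
          basis_mul_basis, smul_smul, smul_smul, ← pow_add, ← pow_add, loops_assoc, comp_assoc]

noncomputable instance : Ring (BrauerAlgebra F r δ) where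
  __ := (inferInstance : AddCommGroup (BrauerAlgebra F r δ))
  left_distrib := mul_add'
  right_distrib := add_mul'
  zero_mul := zero_mul'
  mul_zero := mul_zero'
  mul_assoc := mul_assoc'
  one_mul := one_mul'
  mul_one := mul_one'

noncomputable instance : Algebra F (BrauerAlgebra F r δ) :=
  Algebra.ofModule smul_mul' fun s x y => mul_smul' s x y

variable (δ) in
/-- A diagram as an element of the Brauer algebra. -/
noncomputable def ofDiagram (d : BrauerDiagram r) : BrauerAlgebra F r δ := basis F r δ d

end BrauerAlgebra

/-! Diagrams with arbitrary numbers of dots in their two rows are the morphisms of a category. The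
engine of the proof is that `P * Q` and `Q * P` have the same characteristic polynomial, the same
minimal polynomial up to powers of `X`, and equally large eigenspaces away from `0`
(`Matrix.SameNonzeroSpectrum.mul_comm`).

A diagram `d` with a horizontal edge is cut through its vertical edges, `d = ab`, so that `ba` is a
diagram on fewer dots, possibly with loops. Iterating leads to a permutation `σ` of a finite set and
a number `m` of loops. As `ρ` represents only the `r`-dot diagrams, a smaller dot set `X` of the
same parity is made a retract of the `r`-dot set, and an endomorphism `x` of `X` is represented by
`ρ (proj * x * incl)`, divided by the loops of `incl * proj` (`BrauerAlgebra.compress`). Loops are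
needed there only when `X` is empty. If `δ = 0` they cannot be divided out; then the matrix on one
side is zero and the other is zero or squares to zero. This gives `compress_mul_comm`, the exchange
of `ab` and `ba` across different objects.

It remains to see that the cycle type determines `m` and the conjugacy class of `σ`. Stack copies of
`d` indexed by `ℤ` and let `ℤ` shift the set of connected components. Passing from `ba` to `ab`
regroups the same infinite picture, up to the loops, each of which yields a free orbit. Hence the
components for `d` are those for `σ`, on which the shift is `σ⁻¹`, together with `m` copies of `ℤ`
(`exists_perm_of_retraction`). On the other hand the shift orbits correspond to the components in
the definition of the cycle type, and the number attached to a component generates the stabilizer,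
zero meaning a free orbit (`exists_transversal`). So equal cycle types give isomorphic `ℤ`-sets,
hence equal `m` and conjugate permutations, and conjugation is one more exchange of `ab` and `ba`.
-/

open Polynomial in
/-- Two square matrices that agree in all spectral data away from the eigenvalue `0`, and have the
same characteristic polynomial. -/
structure Matrix.SameNonzeroSpectrum {F : Type*} [Field F] {n : ℕ}
    (A B : Matrix (Fin n) (Fin n) F) : Prop where
  charpoly_eq : A.charpoly = B.charpoly
  minpoly_eq : ∃ i j : ℕ, X ^ i * minpoly F A = X ^ j * minpoly F B
  finrank_eq : ∀ μ : F, μ ≠ 0 →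
    Module.finrank F (Module.End.eigenspace (Matrix.toLin' A) μ) =
      Module.finrank F (Module.End.eigenspace (Matrix.toLin' B) μ)

/-! ### Comparison of the spectra of `P * Q` and `Q * P`. -/

namespace Matrix.SameNonzeroSpectrum

open Polynomial

variable {F : Type*} [Field F] {n : ℕ} {A B C : Matrix (Fin n) (Fin n) F}

theorem refl (A : Matrix (Fin n) (Fin n) F) : SameNonzeroSpectrum A A :=
  ⟨rfl, ⟨0, 0, rfl⟩, fun _ _ => rfl⟩

theorem symm (h : SameNonzeroSpectrum A B) : SameNonzeroSpectrum B A :=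
  ⟨h.charpoly_eq.symm, let ⟨i, j, e⟩ := h.minpoly_eq; ⟨j, i, e.symm⟩,
    fun μ hμ => (h.finrank_eq μ hμ).symm⟩

theorem trans (h : SameNonzeroSpectrum A B) (h' : SameNonzeroSpectrum B C) :
    SameNonzeroSpectrum A C := by
  refine ⟨h.charpoly_eq.trans h'.charpoly_eq, ?_, fun μ hμ =>
    (h.finrank_eq μ hμ).trans (h'.finrank_eq μ hμ)⟩
  obtain ⟨i, j, e⟩ := h.minpoly_eq
  obtain ⟨k, l, e'⟩ := h'.minpoly_eq
  refine ⟨k + i, j + l, ?_⟩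
  rw [pow_add, mul_assoc, e, mul_left_comm, e', pow_add, mul_assoc]

/-- For every polynomial `f`, evaluating `X * f` at `Q * P` gives `Q * f(P * Q) * P`; take `f` to be
the minimal polynomial of `P * Q`. -/
theorem minpoly_dvd_X_mul (P Q : Matrix (Fin n) (Fin n) F) :
    minpoly F (Q * P) ∣ X * minpoly F (P * Q) := by
  apply minpoly.dvd
  have h : ∀ f : F[X], aeval (Q * P) (X * f) = Q * aeval (P * Q) f * P := by
    intro f
    induction f using Polynomial.induction_on with
    | C a =>
      simp [Algebra.algebraMap_eq_smul_one]
    | add f g hf hg => rw [mul_add, map_add, hf, hg, map_add, mul_add, add_mul]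
    | monomial k a ih =>
      have : (X : F[X]) * (C a * X ^ (k + 1)) = X * (C a * X ^ k) * X := by ring
      rw [this, map_mul, ih, aeval_X]
      have : (C a * X ^ (k + 1) : F[X]) = (C a * X ^ k) * X := by ring
      rw [this, map_mul _ _ X, aeval_X]
      simp only [mul_assoc]
  rw [h, minpoly.aeval, mul_zero, zero_mul]

/-- `Q` maps one eigenspace into the other. It is injective there, because `Q v = 0` would give `μ •
v = P (Q v) = 0`. -/
theorem finrank_eigenspace_mul_le (P Q : Matrix (Fin n) (Fin n) F) {μ : F} (hμ : μ ≠ 0) :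
    Module.finrank F (Module.End.eigenspace (Matrix.toLin' (P * Q)) μ) ≤
      Module.finrank F (Module.End.eigenspace (Matrix.toLin' (Q * P)) μ) := by
  have hmem : ∀ v ∈ Module.End.eigenspace (Matrix.toLin' (P * Q)) μ,
      Matrix.toLin' Q v ∈ Module.End.eigenspace (Matrix.toLin' (Q * P)) μ := by
    intro v hv
    rw [Module.End.mem_eigenspace_iff, Matrix.toLin'_mul, LinearMap.comp_apply] at hv ⊢
    rw [hv, map_smul]
  refine LinearMap.finrank_le_finrank_of_injective
    (f := (Matrix.toLin' Q).restrict hmem) ?_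
  rw [injective_iff_map_eq_zero]
  rintro ⟨v, hv⟩ h
  have h0 : Matrix.toLin' Q v = 0 := congrArg Subtype.val h
  rw [Module.End.mem_eigenspace_iff, Matrix.toLin'_mul, LinearMap.comp_apply, h0, map_zero] at hv
  exact Subtype.ext ((smul_eq_zero.1 hv.symm).resolve_left hμ)

/-- The two cofactors multiply to a power of the prime `X`, so each is a power of `X` up to a unit,
and monicity removes the unit. -/
theorem of_dvd {f g : F[X]} (hf : f.Monic) (hg : g.Monic) {k l : ℕ} (h : f ∣ X ^ k * g)
    (h' : g ∣ X ^ l * f) : ∃ i j : ℕ, X ^ i * f = X ^ j * g := by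
  obtain ⟨u, hu⟩ := h
  obtain ⟨v, hv⟩ := h'
  have huv : u * v = X ^ (k + l) := by
    refine mul_left_cancel₀ (mul_ne_zero hf.ne_zero hg.ne_zero) ?_
    calc f * g * (u * v) = (f * u) * (g * v) := by ring
      _ = f * g * X ^ (k + l) := by rw [← hu, ← hv, pow_add]; ring
  obtain ⟨i, -, hi⟩ := (dvd_prime_pow prime_X _).1 (Dvd.intro _ huv)
  have hum : u.Monic := hf.of_mul_monic_left (hu ▸ (monic_X_pow k).mul hg)
  have hui : u = X ^ i := eq_of_monic_of_associated hum (monic_X_pow i) hi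
  exact ⟨i, k, by rw [hu, hui, mul_comm]⟩

theorem mul_comm (P Q : Matrix (Fin n) (Fin n) F) : SameNonzeroSpectrum (P * Q) (Q * P) where
  charpoly_eq := Matrix.charpoly_mul_comm P Q
  minpoly_eq := of_dvd (k := 1) (l := 1)
    (minpoly.monic (Matrix.isIntegral _)) (minpoly.monic (Matrix.isIntegral _))
    (by rw [pow_one]; exact minpoly_dvd_X_mul Q P) (by rw [pow_one]; exact minpoly_dvd_X_mul P Q)
  finrank_eq _ hμ := le_antisymm (finrank_eigenspace_mul_le P Q hμ)
    (finrank_eigenspace_mul_le Q P hμ)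

/-- Serves the degenerate case `δ = 0`, where one of the two matrices to be compared vanishes. -/
theorem zero_of_mul_self (h : A * A = 0) : SameNonzeroSpectrum A 0 where
  charpoly_eq := by
    have h1 : ∀ B : Matrix (Fin n) (Fin n) F, IsNilpotent B → B.charpoly = X ^ n := by
      intro B hB
      have := Matrix.isNilpotent_charpoly_sub_pow_of_isNilpotent hB
      simpa [sub_eq_zero] using this.eq_zero
    rw [h1 A ⟨2, by rw [pow_two, h]⟩, h1 0 (IsNilpotent.zero)]
  minpoly_eq := by
    refine of_dvd (k := 2) (l := 2) (minpoly.monic (Matrix.isIntegral _))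
      (minpoly.monic (Matrix.isIntegral _)) (Dvd.dvd.mul_right ?_ _) (Dvd.dvd.mul_right ?_ _)
    · exact minpoly.dvd _ _ (by simp [pow_two, h])
    · exact minpoly.dvd _ _ (by simp)
  finrank_eq μ hμ := by
    have h1 : ∀ B : Matrix (Fin n) (Fin n) F, B * B = 0 →
        Module.End.eigenspace (Matrix.toLin' B) μ = ⊥ := by
      intro B hB
      rw [eq_bot_iff]
      intro v hv
      rw [Module.End.mem_eigenspace_iff] at hv
      have h2 : Matrix.toLin' (B * B) v = (μ * μ) • v := by
        rw [Matrix.toLin'_mul, LinearMap.comp_apply, hv, map_smul, hv, smul_smul]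
      rw [hB, map_zero, LinearMap.zero_apply] at h2
      exact (smul_eq_zero.1 h2.symm).resolve_left (mul_ne_zero hμ hμ)
    rw [h1 A h, h1 0 (mul_zero 0)]

theorem minpoly_eq_X_pow_mul (h : SameNonzeroSpectrum A B) :
    ∃ k : ℕ, minpoly F A = X ^ k * minpoly F B ∨ minpoly F B = X ^ k * minpoly F A := by
  obtain ⟨i, j, e⟩ := h.minpoly_eq
  rcases le_total i j with hij | hij
  · obtain ⟨k, rfl⟩ := Nat.exists_eq_add_of_le hij
    refine ⟨k, .inl (mul_left_cancel₀ (pow_ne_zero i X_ne_zero) ?_)⟩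
    rw [e, pow_add, mul_assoc]
  · obtain ⟨k, rfl⟩ := Nat.exists_eq_add_of_le hij
    refine ⟨k, .inr (mul_left_cancel₀ (pow_ne_zero j X_ne_zero) ?_)⟩
    rw [← e, pow_add, mul_assoc]

theorem hasEigenvalue_iff (h : SameNonzeroSpectrum A B) {μ : F} (hμ : μ ≠ 0) :
    Module.End.HasEigenvalue (Matrix.toLin' A) μ ↔
      Module.End.HasEigenvalue (Matrix.toLin' B) μ := by
  rw [Module.End.hasEigenvalue_iff, Module.End.hasEigenvalue_iff, Ne, Ne,
    ← Submodule.finrank_eq_zero, ← Submodule.finrank_eq_zero, h.finrank_eq μ hμ]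

end Matrix.SameNonzeroSpectrum

namespace PerfectMatching

variable {W X Y Z : Type*}

/-! ### Diagrams with a recorded number of loops -/

/-- A diagram together with an exponent of the loop parameter. -/
@[ext]
structure Scaled (X Y : Type*) where
  exponent : ℕ
  matching : PerfectMatching (X ⊕ Y)

/-- A diagram without any loop. -/
def scaled (a : PerfectMatching (X ⊕ Y)) : Scaled X Y := ⟨0, a⟩

namespace Scaled

/-- Add `k` loops. -/
def addLoops (k : ℕ) (x : Scaled X Y) : Scaled X Y := ⟨k + x.exponent, x.matching⟩

theorem addLoops_zero (x : Scaled X Y) : x.addLoops 0 = x := by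
  ext1
  exacts [zero_add _, rfl]

variable [Finite W] [Finite X] [Finite Y] [Finite Z]

/-- Concatenation, recording the loops instead of deleting them. -/
noncomputable def mul (x : Scaled X Y) (y : Scaled Y Z) : Scaled X Z :=
  ⟨x.exponent + y.exponent + loops x.matching y.matching, comp x.matching y.matching⟩

theorem mul_assoc (x : Scaled W X) (y : Scaled X Y) (z : Scaled Y Z) :
    (x.mul y).mul z = x.mul (y.mul z) := by
  ext1
  · have := loops_assoc x.matching y.matching z.matching
    simp only [mul]
    omega
  · exact comp_assoc _ _ _

theorem one_mul (x : Scaled X Y) : (scaled (one X)).mul x = x := by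
  ext1
  · simp [mul, scaled, loops_one_left]
  · exact one_comp _

theorem addLoops_mul (k : ℕ) (x : Scaled X Y) (y : Scaled Y Z) :
    (x.addLoops k).mul y = (x.mul y).addLoops k := by
  ext1
  · simp only [mul, addLoops]
    omega
  · rfl

theorem mul_addLoops (k : ℕ) (x : Scaled X Y) (y : Scaled Y Z) :
    x.mul (y.addLoops k) = (x.mul y).addLoops k := by
  ext1
  · simp only [mul, addLoops]
    omega
  · rfl

end Scaled

section Loops

/-- Without outer dots every component is a loop. This is why retracting onto the empty object may
cost a factor `δ`. -/
theorem loops_pos [Finite X] [Finite Y] [Finite Z] [IsEmpty X] [IsEmpty Z] [Nonempty Y]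
    (a : PerfectMatching (X ⊕ Y)) (b : PerfectMatching (Y ⊕ Z)) : 0 < loops a b := by
  have : Nonempty {c : Quotient (stack a b) //
      ∀ e : X ⊕ Z, Quotient.mk (stack a b) (outer e) ≠ c} :=
    ⟨⟨Quotient.mk _ (.inr (.inl (Classical.arbitrary Y))), fun e => isEmptyElim e⟩⟩
  exact Nat.card_pos

theorem loops_of_isEmpty [IsEmpty Y] (a : PerfectMatching (X ⊕ Y))
    (b : PerfectMatching (Y ⊕ Z)) : loops a b = 0 :=
  loops_eq_zero fun y => isEmptyElim y

end Loops

/-- A map from the middle row to the outer dots that respects all edges determines the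
concatenation. -/
theorem comp_eq_of_map [Finite X] [Finite Y] [Finite Z] {a : PerfectMatching (X ⊕ Y)}
    {b : PerfectMatching (Y ⊕ Z)} {c : PerfectMatching (X ⊕ Z)} (g : Y → X ⊕ Z)
    (ha : ∀ p, c.pairs (Sum.elim Sum.inl g p) (Sum.elim Sum.inl g (a.partner p)))
    (hb : ∀ p, c.pairs (Sum.elim g Sum.inr p) (Sum.elim g Sum.inr (b.partner p))) :
    comp a b = c := by
  have hle : stack a b ≤ c.pairs.comap (Sum.elim Sum.inl (Sum.elim g Sum.inr)) := by
    have hu : ∀ p : X ⊕ Y, Sum.elim Sum.inl (Sum.elim g Sum.inr) (upper p : X ⊕ (Y ⊕ Z)) =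
        Sum.elim Sum.inl g p := by rintro (e | e) <;> rfl
    have hl : ∀ p : Y ⊕ Z, Sum.elim Sum.inl (Sum.elim g Sum.inr) (lower p : X ⊕ (Y ⊕ Z)) =
        Sum.elim g Sum.inr p := by rintro (e | e) <;> rfl
    refine stack_le (fun p => ?_) (fun p => ?_)
    · rw [Setoid.comap_rel, hu, hu]
      exact ha p
    · rw [Setoid.comap_rel, hl, hl]
      exact hb p
  have ho : ∀ e : X ⊕ Z, Sum.elim Sum.inl (Sum.elim g Sum.inr) (outer e : X ⊕ (Y ⊕ Z)) = e := by
    rintro (e | e) <;> rfl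
  ext e : 2
  have h : _ = _ ∨ _ = _ := hle (stack_comp_partner a b e)
  rw [ho, ho] at h
  exact h.resolve_left ((comp a b).partner_ne e)

/-- Pairing each point with its partner makes the sum of ones vanish modulo 2. The parity is needed
to embed the cut object into `r` dots. -/
theorem even_card [Fintype X] (m : PerfectMatching X) : Even (Fintype.card X) := by
  have h : ∑ _x : X, (1 : ZMod 2) = 0 :=
    Finset.sum_involution (fun x _ => m.partner x) (fun _ _ => by decide)
      (fun x _ _ => m.partner_ne x) (fun _ _ => Finset.mem_univ _)
      (fun x _ => m.partner_partner x)
  rw [Finset.sum_const, Finset.card_univ, nsmul_eq_mul, mul_one] at h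
  exact (ZMod.natCast_eq_zero_iff_even).1 h

/-! ### Diagrams of bijections -/

/-- The diagram with vertical edges only that is given by a bijection. -/
def ofEquiv (e : X ≃ Y) : PerfectMatching (X ⊕ Y) where
  partner := Sum.elim (fun x => .inr (e x)) (fun y => .inl (e.symm y))
  partner_partner := by rintro (x | x) <;> simp
  partner_ne := by rintro (x | x) <;> simp

theorem ofEquiv_refl : ofEquiv (Equiv.refl X) = one X := by
  ext e : 2
  rcases e with e | e <;> rfl

theorem comp_ofEquiv [Finite X] [Finite Y] [Finite Z] (e : X ≃ Y) (f : Y ≃ Z) :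
    comp (ofEquiv e) (ofEquiv f) = ofEquiv (e.trans f) := by
  refine comp_eq_of_map (fun y => .inr (f y)) ?_ ?_
  · rintro (x | y)
    · exact .inr rfl
    · right
      simp [ofEquiv]
  · rintro (y | z)
    · exact .inl rfl
    · left
      simp [ofEquiv]

theorem loops_ofEquiv_left (e : X ≃ Y) (b : PerfectMatching (Y ⊕ Z)) :
    loops (ofEquiv e) b = 0 :=
  loops_eq_zero fun y => ⟨.inl (e.symm y), by
    have : stack (ofEquiv e) b (upper (.inl (e.symm y)))
        (upper ((ofEquiv e).partner (.inl (e.symm y)))) := .rel _ _ (.upper _)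
    simpa [ofEquiv, upper, outer] using this⟩

/-- The end point of the reduction: the map from top to bottom dots is injective on a finite set, so
the bottom row has no horizontal edges either. -/
theorem exists_eq_ofEquiv [Finite X] (d : PerfectMatching (X ⊕ X))
    (h : ∀ x, ∃ y, d.partner (.inl x) = .inr y) : ∃ σ : Equiv.Perm X, d = ofEquiv σ := by
  choose f hf using h
  have hinj : Function.Injective f := by
    intro x x' hx
    have := congrArg d.partner ((hf x).trans ((congrArg _ hx).trans (hf x').symm))
    rwa [d.partner_partner, d.partner_partner, Sum.inl.injEq] at this
  refine ⟨Equiv.ofBijective f (Finite.injective_iff_bijective.1 hinj), ?_⟩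
  ext e : 2
  rcases e with x | y
  · exact hf x
  · obtain ⟨x, rfl⟩ := (Finite.injective_iff_bijective.1 hinj).2 y
    rw [← hf, d.partner_partner]
    simp [ofEquiv, hf, Equiv.ofBijective_symm_apply_apply f]

/-! ### Cutting a diagram along its vertical edges -/

section Cut

/-- The dots of the top row that lie on vertical edges. -/
def Through (d : PerfectMatching (X ⊕ X)) : Type _ := {x : X // (d.partner (.inl x)).isRight}

instance [Finite X] (d : PerfectMatching (X ⊕ X)) : Finite (Through d) :=
  inferInstanceAs (Finite (Subtype _))

/-- The upper half of a diagram that is cut along its vertical edges. -/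
def cutUpper (d : PerfectMatching (X ⊕ X)) : PerfectMatching (X ⊕ Through d) where
  partner
    -- In the `else` case the partner lies in the top row, so the second branch of `elim` is a dummy
    -- value.
    | .inl x => if h : (d.partner (.inl x)).isRight then .inr ⟨x, h⟩ else
        (d.partner (.inl x)).elim .inl (fun _ => .inl x)
    | .inr y => .inl y.1
  partner_partner := by
    rintro (x | ⟨x, hx⟩)
    · rcases hd : d.partner (.inl x) with y | y
      · have : d.partner (.inl y) = .inl x := by rw [← hd, d.partner_partner]
        simp [hd, this]
      · simp [hd]
    · simp [hx]
  partner_ne := by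
    rintro (x | ⟨x, hx⟩)
    · rcases hd : d.partner (.inl x) with y | y
      · have := d.partner_ne (.inl x)
        rw [hd] at this
        simpa [hd] using this
      · simp [hd]
    · simp

/-- The lower half of a diagram that is cut along its vertical edges. -/
def cutLower (d : PerfectMatching (X ⊕ X)) : PerfectMatching (Through d ⊕ X) where
  partner
    | .inl y => .inr ((d.partner (.inl y.1)).getRight y.2)
    | .inr z => if h : (d.partner (.inr z)).isLeft then
        .inl ⟨(d.partner (.inr z)).getLeft h, by rw [Sum.inl_getLeft, d.partner_partner]; rfl⟩
      else .inr ((d.partner (.inr z)).elim id id)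
  partner_partner := by
    rintro (⟨x, hx⟩ | z)
    · obtain ⟨z, hz⟩ := Sum.isRight_iff.1 hx
      have hz' : d.partner (.inr z) = .inl x := by rw [← hz, d.partner_partner]
      simp [hz, hz']
    · rcases hd : d.partner (.inr z) with x | z'
      · have hd' : d.partner (.inl x) = .inr z := by rw [← hd, d.partner_partner]
        simp [hd, hd']
      · have hd' : d.partner (.inr z') = .inr z := by rw [← hd, d.partner_partner]
        simp [hd, hd']
  partner_ne := by
    rintro (⟨x, hx⟩ | z)
    · simp
    · rcases hd : d.partner (.inr z) with x | z'
      · simp [hd]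
      · have := d.partner_ne (.inr z)
        rw [hd] at this
        simpa [hd] using this

theorem stack_cut (d : PerfectMatching (X ⊕ X)) (y : Through d) :
    stack (cutUpper d) (cutLower d) (outer (.inl y.1)) (.inr (.inl y)) := by
  have h : stack (cutUpper d) (cutLower d) (upper (.inr y))
      (upper ((cutUpper d).partner (.inr y))) := .rel _ _ (.upper _)
  exact .symm _ _ h

theorem loops_cut (d : PerfectMatching (X ⊕ X)) : loops (cutUpper d) (cutLower d) = 0 :=
  loops_eq_zero fun y => ⟨.inl y.1, stack_cut d y⟩

theorem comp_cut [Finite X] (d : PerfectMatching (X ⊕ X)) :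
    comp (cutUpper d) (cutLower d) = d := by
  refine comp_eq_of_map (fun y => .inl y.1) ?_ ?_
  · rintro (x | y)
    · rcases hd : d.partner (.inl x) with y | y
      · exact .inr (by simp [cutUpper, hd])
      · left
        have : (d.partner (.inl x)).isRight := by rw [hd]; rfl
        simp only [cutUpper, dif_pos this]
        rfl
    · exact .inl rfl
  · rintro (y | z)
    · exact .inr (by simp [cutLower])
    · right
      rcases hd : d.partner (.inr z) with x | z'
      · simp only [cutLower, Sum.elim_inr, hd, Sum.isLeft_inl, dif_pos, Sum.getLeft_inl]
        rfl
      · simp [cutLower, hd]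

/-- The dot `x` lies on a horizontal edge and is lost by cutting. This strict drop drives the
induction of `exists_perm_of_retraction`. -/
theorem card_through_lt [Finite X] (d : PerfectMatching (X ⊕ X)) {x y : X}
    (h : d.partner (.inl x) = .inl y) : Nat.card (Through d) < Nat.card X := by
  have := Fintype.ofFinite X
  classical
  have : Nat.card (Through d) = Fintype.card {x : X // (d.partner (.inl x)).isRight} :=
    Nat.card_eq_fintype_card (α := {x : X // (d.partner (.inl x)).isRight})
  rw [this, Nat.card_eq_fintype_card]
  exact Fintype.card_subtype_lt (x := x) (by simp [h])

end Cut
end PerfectMatching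

namespace PerfectMatching

variable {V W X Y Z : Type*}

/-! ### Retractions in the category of diagrams -/

/-- `X` is a retract of `W` in the category of diagrams; no loops arise unless `X` is empty. -/
structure Retraction (X W : Type*) [Finite X] [Finite W] where
  incl : PerfectMatching (X ⊕ W)
  proj : PerfectMatching (W ⊕ X)
  comp_eq : comp incl proj = one X
  loops_eq_zero : Nonempty X → loops incl proj = 0

namespace Retraction

/-- A bijection as a retraction. -/
def ofEquiv [Finite X] [Finite W] (e : X ≃ W) : Retraction X W where
  incl := .ofEquiv e
  proj := .ofEquiv e.symm
  comp_eq := by rw [comp_ofEquiv, Equiv.self_trans_symm, ofEquiv_refl]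
  loops_eq_zero _ := loops_ofEquiv_left _ _

/-- The loops of the composite of the two diagrams of a retraction. -/
noncomputable def loops [Finite X] [Finite W] (R : Retraction X W) : ℕ :=
  PerfectMatching.loops R.incl R.proj

theorem incl_mul_proj [Finite X] [Finite W] (R : Retraction X W) :
    R.incl.scaled.mul R.proj.scaled = (one X).scaled.addLoops R.loops := by
  ext1
  · simp [Scaled.mul, scaled, Scaled.addLoops, loops]
  · exact R.comp_eq

theorem incl_mul_proj_mul [Finite X] [Finite W] [Finite Y] (R : Retraction X W)
    (z : Scaled X Y) :
    R.incl.scaled.mul (R.proj.scaled.mul z) = z.addLoops R.loops := by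
  rw [← Scaled.mul_assoc, incl_mul_proj, Scaled.addLoops_mul, Scaled.one_mul]

/-- Retractions compose. -/
noncomputable def trans [Finite V] [Finite X] [Finite W] [Nonempty X] (R : Retraction V X)
    (S : Retraction X W) : Retraction V W where
  incl := comp R.incl S.incl
  proj := comp S.proj R.proj
  comp_eq := by
    rw [comp_assoc, ← comp_assoc S.incl, S.comp_eq, one_comp, R.comp_eq]
  loops_eq_zero h := by
    -- Computed with loops recorded, the fourfold product has exponent zero. The loops of the
    -- composite retraction are one summand of that exponent, so they vanish too.
    have h1 : (R.incl.scaled.mul S.incl.scaled).mul (S.proj.scaled.mul R.proj.scaled) =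
        (one V).scaled := by
      have hR : R.loops = 0 := R.loops_eq_zero h
      have hS : S.loops = 0 := S.loops_eq_zero inferInstance
      rw [Scaled.mul_assoc, S.incl_mul_proj_mul, Scaled.mul_addLoops, R.incl_mul_proj, hR, hS,
        Scaled.addLoops_zero, Scaled.addLoops_zero]
    have h2 := congrArg Scaled.exponent h1
    simp only [Scaled.mul, scaled] at h2
    omega

/-- Two additional dots, when there is already one. -/
noncomputable def addPairOfNonempty [Finite X] (x₀ : X) : Retraction X (X ⊕ Bool) := by
  classical
  -- The identity together with an arc joining the two new dots in the bottom row.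
  let i : PerfectMatching (X ⊕ (X ⊕ Bool)) :=
    { partner := Sum.elim (fun x => .inr (.inl x))
        (Sum.elim (fun x => .inl x) (fun b => .inr (.inr (!b))))
      partner_partner := by rintro (x | x | b) <;> simp
      partner_ne := by rintro (x | x | b) <;> simp }
  -- The arc is absorbed into the strand of `x₀`: in the composite this strand runs through the
  -- middle dots `x₀`, `false`, `true` and ends at the bottom `x₀`. The zigzag straightens and no
  -- loop is closed.
  let p : PerfectMatching ((X ⊕ Bool) ⊕ X) :=
    { partner := Sum.elim (Sum.elim
        (fun x => if x = x₀ then .inl (.inr false) else .inr x)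
        (fun b => if b then .inr x₀ else .inl (.inl x₀)))
        (fun x => if x = x₀ then .inl (.inr true) else .inl (.inl x))
      partner_partner := by
        rintro ((x | b) | x)
        · by_cases h : x = x₀ <;> simp [h]
        · cases b <;> simp
        · by_cases h : x = x₀ <;> simp [h]
      partner_ne := by
        rintro ((x | b) | x)
        · by_cases h : x = x₀ <;> simp [h]
        · cases b <;> simp
        · by_cases h : x = x₀ <;> simp [h] }
  have hs : ∀ b, stack i p (outer (if b then .inr x₀ else .inl x₀)) (.inr (.inl (.inr b))) := by
    intro b
    cases b
    · have h1 : stack i p (upper (.inl x₀)) (upper (i.partner (.inl x₀))) := .rel _ _ (.upper _)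
      have h2 : stack i p (lower (.inl (.inl x₀))) (lower (p.partner (.inl (.inl x₀)))) :=
        .rel _ _ (.lower _)
      have h3 : p.partner (.inl (.inl x₀)) = .inl (.inr false) := by simp [p]
      rw [h3] at h2
      exact .trans _ _ _ h1 h2
    · have h2 : stack i p (lower (.inr x₀)) (lower (p.partner (.inr x₀))) :=
        .rel _ _ (.lower _)
      have h3 : p.partner (.inr x₀) = .inl (.inr true) := by simp [p]
      rw [h3] at h2
      exact h2
  refine ⟨i, p, ?_, fun _ => PerfectMatching.loops_eq_zero ?_⟩
  · refine comp_eq_of_map (Sum.elim Sum.inl fun _ => .inl x₀) ?_ ?_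
    · rintro (x | x | b)
      · exact .inl rfl
      · exact .inl rfl
      · exact .inl rfl
    · rintro ((x | b) | x)
      · by_cases h : x = x₀
        · left
          simp [p, h]
        · right
          simp [p, h, one]
      · cases b
        · left
          simp [p]
        · right
          simp [p, one]
      · by_cases h : x = x₀
        · right
          simp [p, h, one]
        · right
          simp [p, h, one]
  · rintro (x | b)
    · exact ⟨.inl x, .rel _ _ (.upper (.inl x))⟩
    · exact ⟨_, hs b⟩

/-- Two additional dots, when there are no others. -/
noncomputable def addPairOfIsEmpty [Finite X] [IsEmpty X] : Retraction X (X ⊕ Bool) where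
  -- The two arcs on the new dots close up to a loop, so `incl` followed by `proj` is the empty
  -- diagram with a loop.
  incl :=
    { partner := Sum.elim (fun x => isEmptyElim x)
        (Sum.elim (fun x => isEmptyElim x) (fun b => .inr (.inr (!b))))
      partner_partner := by rintro (x | x | b) <;> first | exact isEmptyElim x | simp
      partner_ne := by rintro (x | x | b) <;> first | exact isEmptyElim x | simp }
  proj :=
    { partner := Sum.elim (Sum.elim (fun x => isEmptyElim x) (fun b => .inl (.inr (!b))))
        (fun x => isEmptyElim x)
      partner_partner := by rintro ((x | b) | x) <;> first | exact isEmptyElim x | simp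
      partner_ne := by rintro ((x | b) | x) <;> first | exact isEmptyElim x | simp }
  comp_eq := by
    ext e : 2
    exact isEmptyElim e
  loops_eq_zero h := (not_nonempty_iff.2 ‹IsEmpty X› h).elim

/-- Pairs of dots are added at the small end, so the intermediate object `X ⊕ Bool` is nonempty, as
`trans` requires. -/
theorem nonempty_of_card (k : ℕ) : ∀ (X W : Type) [Finite X] [Finite W],
    Nat.card X + 2 * k = Nat.card W → Nonempty (Retraction X W) := by
  induction k with
  | zero =>
    intro X W _ _ h
    exact ⟨ofEquiv (Finite.card_eq.1 h).some⟩
  | succ k ih =>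
    intro X W _ _ h
    obtain ⟨S⟩ := ih (X ⊕ Bool) W (by
      rw [Nat.card_sum, Nat.card_eq_fintype_card (α := Bool), Fintype.card_bool]
      omega)
    rcases isEmpty_or_nonempty X with hX | ⟨⟨x₀⟩⟩
    · exact ⟨addPairOfIsEmpty.trans S⟩
    · exact ⟨(addPairOfNonempty x₀).trans S⟩

theorem nonempty_of_card_le {X W : Type} [Finite X] [Finite W] (h : Nat.card X ≤ Nat.card W)
    (h' : Even (Nat.card X + Nat.card W)) : Nonempty (Retraction X W) := by
  obtain ⟨k, hk⟩ := h'
  -- Here `2 * k` is the sum of the cardinalities, so `k - Nat.card X` is half their difference.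
  exact nonempty_of_card (k - Nat.card X) X W (by omega)

end Retraction

theorem even_natCard_add {X Y : Type*} [Finite X] [Finite Y] (m : PerfectMatching (X ⊕ Y)) :
    Even (Nat.card X + Nat.card Y) := by
  have := Fintype.ofFinite X
  have := Fintype.ofFinite Y
  rw [Nat.card_eq_fintype_card, Nat.card_eq_fintype_card, ← Fintype.card_sum]
  exact m.even_card

end PerfectMatching

/-! ### Representing endomorphisms of smaller objects through retractions. -/

namespace BrauerAlgebra

open PerfectMatching Matrix

section OfScaled

variable {F : Type*} [CommRing F] {r : ℕ} (δ : F)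

/-- A diagram with loops as an element of the Brauer algebra. -/
noncomputable def ofScaled (x : Scaled (Fin r) (Fin r)) : BrauerAlgebra F r δ :=
  δ ^ x.exponent • ofDiagram δ x.matching

theorem ofScaled_mul (x y : Scaled (Fin r) (Fin r)) :
    ofScaled δ (x.mul y) = ofScaled δ x * ofScaled δ y := by
  simp only [ofScaled, ofDiagram, Scaled.mul]
  rw [smul_mul', mul_smul', basis_mul_basis, smul_smul, smul_smul, pow_add, pow_add, mul_assoc]

theorem ofScaled_addLoops (k : ℕ) (x : Scaled (Fin r) (Fin r)) :
    ofScaled δ (x.addLoops k) = δ ^ k • ofScaled δ x := by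
  rw [ofScaled, Scaled.addLoops, pow_add, ← smul_smul]
  rfl

theorem ofScaled_scaled (d : BrauerDiagram r) : ofScaled δ d.scaled = ofDiagram δ d := by
  rw [ofScaled, scaled, pow_zero, one_smul]

end OfScaled

variable {F : Type*} [Field F] {δ : F} {r n : ℕ}
  (ρ : BrauerAlgebra F r δ →ₐ[F] Matrix (Fin n) (Fin n) F)

/-- The matrix attached to an endomorphism of a retract of the object with `r` dots. -/
noncomputable def compress {X : Type} [Finite X] (R : Retraction X (Fin r)) (x : Scaled X X) :
    Matrix (Fin n) (Fin n) F :=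
  -- The scalar compensates the loops of `incl` followed by `proj`. If `δ ^ R.loops = 0`, its
  -- inverse is `0` by convention and the matrix is zero.
  (δ ^ R.loops)⁻¹ • ρ (ofScaled δ (R.proj.scaled.mul (x.mul R.incl.scaled)))

theorem compress_ofEquiv_refl (d : BrauerDiagram r) :
    compress ρ (Retraction.ofEquiv (Equiv.refl (Fin r))) d.scaled = ρ (ofDiagram δ d) := by
  have h : (Retraction.ofEquiv (Equiv.refl (Fin r))).loops = 0 := loops_ofEquiv_left _ _
  rw [compress, h, pow_zero, inv_one, one_smul, ← ofScaled_scaled]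
  congr 2
  simp only [Retraction.ofEquiv, Equiv.refl_symm, ofEquiv_refl, Scaled.one_mul]
  ext1
  · simp [Scaled.mul, scaled, loops_one_right]
  · exact comp_one _

variable {X Y : Type} [Finite X] [Finite Y]

/-- The assumption forces `δ = 0` and `Y` empty, so the right-hand matrix is zero. If `X` is empty
too, so is the left one. Otherwise the square of the left one contains `ba`, a diagram without outer
dots that has a loop, and `δ = 0` kills it. -/
theorem compress_mul_comm_of_eq_zero (R : Retraction X (Fin r)) (S : Retraction Y (Fin r))
    (hS : δ ^ S.loops = 0) (a : Scaled X Y) (b : Scaled Y X) :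
    SameNonzeroSpectrum (compress ρ R (a.mul b)) (compress ρ S (b.mul a)) := by
  have hδ : δ = 0 := eq_zero_of_pow_eq_zero hS
  have hSl : S.loops ≠ 0 := by
    intro h
    rw [h, pow_zero] at hS
    exact one_ne_zero hS
  have hY : IsEmpty Y := by
    by_contra h
    exact hSl (S.loops_eq_zero (not_isEmpty_iff.1 h))
  have hr : Nonempty (Fin r) := by
    by_contra h
    rw [not_nonempty_iff] at h
    exact hSl (loops_of_isEmpty _ _)
  have hzero : compress ρ S (b.mul a) = 0 := by rw [compress, hS, _root_.inv_zero, zero_smul]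
  rw [hzero]
  rcases isEmpty_or_nonempty X with hX | hX
  · have : R.loops ≠ 0 := (loops_pos R.incl R.proj).ne'
    have hR : (δ ^ R.loops)⁻¹ = 0 := by rw [hδ, zero_pow this, _root_.inv_zero]
    rw [compress, hR, zero_smul]
    exact SameNonzeroSpectrum.refl 0
  · refine .zero_of_mul_self ?_
    have hR : R.loops = 0 := R.loops_eq_zero hX
    have hba : (b.mul a).exponent ≠ 0 := by
      have := loops_pos b.matching a.matching
      simp only [Scaled.mul]
      omega
    have h1 : ofScaled δ (R.proj.scaled.mul ((a.mul b).mul R.incl.scaled)) *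
        ofScaled δ (R.proj.scaled.mul ((a.mul b).mul R.incl.scaled)) = 0 := by
      rw [← ofScaled_mul]
      -- Regrouping `(ab)(ab)` as `a(ba)b` exposes the loop of `ba`.
      have : (R.proj.scaled.mul ((a.mul b).mul R.incl.scaled)).mul
          (R.proj.scaled.mul ((a.mul b).mul R.incl.scaled)) =
          (R.proj.scaled.mul (a.mul ((b.mul a).mul (b.mul R.incl.scaled)))) := by
        simp only [Scaled.mul_assoc]
        rw [R.incl_mul_proj_mul, hR, Scaled.addLoops_zero]
      have hpow : δ ^ (R.proj.scaled.mul (a.mul ((b.mul a).mul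
          (b.mul R.incl.scaled)))).exponent = 0 := by
        rw [hδ]
        refine zero_pow ?_
        simp only [Scaled.mul] at hba ⊢
        omega
      rw [this, ofScaled, hpow, zero_smul]
    rw [compress, smul_mul_smul_comm, ← map_mul, h1, map_zero, smul_zero]

/-- With `P` from `proj_R a incl_S` and `Q` from `proj_S b incl_R`, the inner `incl_S proj_S` of `P
* Q` is the identity up to loops, which the scalars cancel; likewise for `Q * P`. -/
theorem compress_mul_comm (R : Retraction X (Fin r)) (S : Retraction Y (Fin r))
    (a : Scaled X Y) (b : Scaled Y X) :
    SameNonzeroSpectrum (compress ρ R (a.mul b)) (compress ρ S (b.mul a)) := by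
  by_cases hS : δ ^ S.loops = 0
  · exact compress_mul_comm_of_eq_zero ρ R S hS a b
  by_cases hR : δ ^ R.loops = 0
  · exact (compress_mul_comm_of_eq_zero ρ S R hR b a).symm
  have h1 : compress ρ R (a.mul b) =
      ((δ ^ R.loops)⁻¹ • ρ (ofScaled δ (R.proj.scaled.mul (a.mul S.incl.scaled)))) *
        ((δ ^ S.loops)⁻¹ • ρ (ofScaled δ (S.proj.scaled.mul (b.mul R.incl.scaled)))) := by
    rw [smul_mul_smul_comm, ← map_mul, ← ofScaled_mul]
    have : (R.proj.scaled.mul (a.mul S.incl.scaled)).mul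
        (S.proj.scaled.mul (b.mul R.incl.scaled)) =
        (R.proj.scaled.mul ((a.mul b).mul R.incl.scaled)).addLoops S.loops := by
      simp only [Scaled.mul_assoc]
      rw [S.incl_mul_proj_mul, Scaled.mul_addLoops, Scaled.mul_addLoops]
    rw [this, ofScaled_addLoops, map_smul, smul_smul, mul_assoc, inv_mul_cancel₀ hS, mul_one,
      compress]
  have h2 : compress ρ S (b.mul a) =
      ((δ ^ S.loops)⁻¹ • ρ (ofScaled δ (S.proj.scaled.mul (b.mul R.incl.scaled)))) *
      ((δ ^ R.loops)⁻¹ • ρ (ofScaled δ (R.proj.scaled.mul (a.mul S.incl.scaled)))) := by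
    rw [smul_mul_smul_comm, ← map_mul, ← ofScaled_mul]
    have : (S.proj.scaled.mul (b.mul R.incl.scaled)).mul
        (R.proj.scaled.mul (a.mul S.incl.scaled)) =
        (S.proj.scaled.mul ((b.mul a).mul S.incl.scaled)).addLoops R.loops := by
      simp only [Scaled.mul_assoc]
      rw [R.incl_mul_proj_mul, Scaled.mul_addLoops, Scaled.mul_addLoops]
    rw [this, ofScaled_addLoops, map_smul, smul_smul, mul_assoc, inv_mul_cancel₀ hR, mul_one,
      compress]
  rw [h1, h2]
  exact .mul_comm _ _

end BrauerAlgebra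

namespace PerfectMatching

variable {V S X Y : Type*}

/-! ### Infinite towers of diagrams -/

/-- A graph on `V × ℤ`, given by its connectedness relation `R`, has connected components `S` on
which the shift of `ℤ` acts as `T`. -/
def IsShiftQuotient (R : Setoid (V × ℤ)) (T : Equiv.Perm S) : Prop :=
  ∃ f : V × ℤ → S, Function.Surjective f ∧ (∀ v l, f (v, l + 1) = T (f (v, l))) ∧
    ∀ u v, R u v ↔ f u = f v

theorem IsShiftQuotient.congr {S' : Type*} {R : Setoid (V × ℤ)} {T : Equiv.Perm S}
    (h : IsShiftQuotient R T) {T' : Equiv.Perm S'} (e : S ≃ S') (he : ∀ s, e (T s) = T' (e s)) :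
    IsShiftQuotient R T' := by
  obtain ⟨f, h1, h2, h3⟩ := h
  refine ⟨e ∘ f, e.surjective.comp h1, fun v l => ?_, fun u v => ?_⟩
  · simp only [Function.comp_apply, h2, he]
  · rw [h3, Function.comp_apply, Function.comp_apply, e.apply_eq_iff_eq]

/-- The shift of `M × ℤ`. -/
def freeShift (M : Type*) : Equiv.Perm (M × ℤ) :=
  Equiv.prodCongr (Equiv.refl M) (Equiv.addRight 1)

/-- The position of a dot of the diagram between the levels `l` and `l + 1`. -/
def level : X ⊕ X → ℤ → X × ℤ
  | .inl x, l => (x, l)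
  | .inr x, l => (x, l + 1)

/-- The edges of the graph obtained by stacking copies of a diagram, indexed by `ℤ`. -/
inductive TowerEdge (d : PerfectMatching (X ⊕ X)) : X × ℤ → X × ℤ → Prop
  | arc (p : X ⊕ X) (l : ℤ) : TowerEdge d (level p l) (level (d.partner p) l)

/-- Connectedness in the graph obtained by stacking copies of a diagram, indexed by `ℤ`. -/
def tower (d : PerfectMatching (X ⊕ X)) : Setoid (X × ℤ) := Relation.EqvGen.setoid (TowerEdge d)

theorem tower_le {d : PerfectMatching (X ⊕ X)} {T : Setoid (X × ℤ)}
    (h : ∀ p l, T (level p l) (level (d.partner p) l)) : tower d ≤ T := by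
  refine Setoid.eqvGen_le ?_
  rintro _ _ ⟨p, l⟩
  exact h p l

/-- A component is labelled by the dot where it crosses level `0`. The strand through `(x, 1)`
crosses level `0` at `σ⁻¹ x`, whence the inverse. -/
theorem isShiftQuotient_tower_ofEquiv (σ : Equiv.Perm X) :
    IsShiftQuotient (tower (ofEquiv σ)) σ⁻¹ := by
  refine ⟨fun u => (σ ^ (-u.2)) u.1, fun x => ⟨(x, 0), by simp⟩, fun v l => ?_, fun u v => ?_⟩
  · change (σ ^ (-(l + 1))) v = _
    rw [neg_add, add_comm, zpow_add, zpow_neg_one, Equiv.Perm.mul_apply]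
  · have hle : tower (ofEquiv σ) ≤ Setoid.ker fun u : X × ℤ => (σ ^ (-u.2)) u.1 := by
      refine tower_le ?_
      have key : ∀ (x : X) (l : ℤ), (σ ^ (-l)) x = (σ ^ (-(l + 1))) (σ x) := by
        intro x l
        rw [← Equiv.Perm.mul_apply, ← zpow_add_one, neg_add_rev, neg_add_cancel_comm]
      rintro (x | y) l
      · exact key x l
      · change (σ ^ (-(l + 1))) y = (σ ^ (-l)) (σ.symm y)
        rw [key (σ.symm y), Equiv.apply_symm_apply]
    refine ⟨fun h => hle h, fun h => ?_⟩
    have h1 : ∀ x (l : ℤ), tower (ofEquiv σ) (x, l) (σ x, l + 1) :=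
      fun x l => .rel _ _ (.arc (.inl x) l)
    have h2 : ∀ (k : ℤ) x l, tower (ofEquiv σ) (x, l) ((σ ^ k) x, l + k) := by
      intro k
      induction k using Int.induction_on with
      | zero =>
        intro x l
        simp only [zpow_zero, Equiv.Perm.one_apply, add_zero]
        exact .refl _
      | succ k ih =>
        intro x l
        have := h1 ((σ ^ (k : ℤ)) x) (l + k)
        rw [← Equiv.Perm.mul_apply, ← zpow_one_add, add_comm 1, add_assoc] at this
        exact .trans _ _ _ (ih x l) this
      | pred k ih =>
        intro x l
        have := h1 ((σ ^ (-(k : ℤ) - 1)) x) (l + (-(k : ℤ) - 1))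
        rw [← Equiv.Perm.mul_apply, ← zpow_one_add, add_comm 1, add_assoc, sub_add_cancel] at this
        exact .trans _ _ _ (ih x l) (.symm _ _ this)
    obtain ⟨x, l⟩ := u
    obtain ⟨y, k⟩ := v
    have hx := h2 (-l) x l
    have hy := h2 (-k) y k
    rw [add_neg_cancel] at hx hy
    change (σ ^ (-l)) x = (σ ^ (-k)) y at h
    rw [h] at hx
    exact .trans _ _ _ hx (.symm _ _ hy)

/-! ### Towers of two alternating diagrams -/

/-- The position of a dot of the three-row picture in the tower of two alternating diagrams. -/
def bilevel : X ⊕ (Y ⊕ X) → ℤ → (X ⊕ Y) × ℤ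
  | .inl x, l => (.inl x, l)
  | .inr (.inl y), l => (.inr y, l)
  | .inr (.inr x), l => (.inl x, l + 1)

/-- The edges of the tower of two alternating diagrams. -/
inductive BitowerEdge (a : PerfectMatching (X ⊕ Y)) (b : PerfectMatching (Y ⊕ X)) :
    (X ⊕ Y) × ℤ → (X ⊕ Y) × ℤ → Prop
  | upper (p : X ⊕ Y) (l : ℤ) :
      BitowerEdge a b (bilevel (PerfectMatching.upper p) l) (bilevel (PerfectMatching.upper (a.partner p)) l)
  | lower (p : Y ⊕ X) (l : ℤ) :
      BitowerEdge a b (bilevel (PerfectMatching.lower p) l) (bilevel (PerfectMatching.lower (b.partner p)) l)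

/-- Connectedness in the tower of two alternating diagrams. -/
def bitower (a : PerfectMatching (X ⊕ Y)) (b : PerfectMatching (Y ⊕ X)) :
    Setoid ((X ⊕ Y) × ℤ) := Relation.EqvGen.setoid (BitowerEdge a b)

section Bitower

variable {a : PerfectMatching (X ⊕ Y)} {b : PerfectMatching (Y ⊕ X)}

theorem bitower_le {T : Setoid ((X ⊕ Y) × ℤ)}
    (ha : ∀ p l, T (bilevel (upper p) l) (bilevel (upper (a.partner p)) l))
    (hb : ∀ p l, T (bilevel (lower p) l) (bilevel (lower (b.partner p)) l)) :
    bitower a b ≤ T := by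
  refine Setoid.eqvGen_le ?_
  rintro _ _ (⟨p, l⟩ | ⟨p, l⟩)
  exacts [ha p l, hb p l]

theorem bitower_of_stack {u v : X ⊕ (Y ⊕ X)} (h : stack a b u v) (l : ℤ) :
    bitower a b (bilevel u l) (bilevel v l) := by
  have hle : stack a b ≤ (bitower a b).comap fun u => bilevel u l :=
    stack_le (fun p => .rel _ _ (.upper p l)) (fun p => .rel _ _ (.lower p l))
  exact hle h

theorem bilevel_outer (e : X ⊕ X) (l : ℤ) :
    bilevel (outer e : X ⊕ (Y ⊕ X)) l = Prod.map Sum.inl id (level e l) := by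
  rcases e with e | e <;> rfl

theorem bitower_of_tower_comp [Finite X] [Finite Y] {u v : X × ℤ} (h : tower (comp a b) u v) :
    bitower a b (Prod.map Sum.inl id u) (Prod.map Sum.inl id v) := by
  have hle : tower (comp a b) ≤ (bitower a b).comap (Prod.map Sum.inl id) := by
    refine tower_le fun p l => ?_
    rw [Setoid.comap_rel, ← bilevel_outer, ← bilevel_outer]
    exact bitower_of_stack (stack_comp_partner a b p) l
  exact hle h

variable (a b) in
/-- The components of the three-row picture that contain no outer dot. -/
abbrev Loop : Type _ :=
  {c : Quotient (stack a b) // ∀ e : X ⊕ X, Quotient.mk (stack a b) (outer e) ≠ c}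

open Classical in
variable (a b) in
/-- Extend a labelling of the components of the tower of the concatenation to the three-row
picture at a given level. -/
noncomputable def rowLabel (f : X × ℤ → S) (w : X ⊕ (Y ⊕ X)) (l : ℤ) : S ⊕ (Loop a b × ℤ) :=
  if h : ∃ e : X ⊕ X, Quotient.mk (stack a b) (outer e) = Quotient.mk (stack a b) w then
    .inl (f (level h.choose l))
  else .inr (⟨Quotient.mk _ w, not_exists.1 h⟩, l)

variable (a b) in
/-- Extend a labelling of the components of the tower of the concatenation to the tower of the two
diagrams. -/
noncomputable def towerLabel (f : X × ℤ → S) : (X ⊕ Y) × ℤ → S ⊕ (Loop a b × ℤ)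
  | (.inl x, l) => .inl (f (x, l))
  | (.inr y, l) => rowLabel a b f (.inr (.inl y)) l

section Label

variable [Finite X] [Finite Y] {f : X × ℤ → S}

/-- The label does not depend on the outer dot chosen: two outer dots in one component are partners
in `comp a b`, hence joined in its tower. -/
theorem rowLabel_of_stack (hf : ∀ u v, tower (comp a b) u v ↔ f u = f v)
    {e : X ⊕ X} {w : X ⊕ (Y ⊕ X)} (h : stack a b (outer e) w) (l : ℤ) :
    rowLabel a b f w l = .inl (f (level e l)) := by
  have hex : ∃ e : X ⊕ X, Quotient.mk (stack a b) (outer e) = Quotient.mk (stack a b) w :=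
    ⟨e, Quotient.sound h⟩
  rw [rowLabel, dif_pos hex]
  have h2 : stack a b (outer e) (outer hex.choose) :=
    .trans _ _ _ h (.symm _ _ (Quotient.exact hex.choose_spec))
  congr 1
  rcases (stack_outer_iff a b _ _).1 h2 with h3 | h3
  · rw [h3]
  · rw [h3, eq_comm, ← hf]
    exact .rel _ _ (.arc e l)

theorem rowLabel_congr (hf : ∀ u v, tower (comp a b) u v ↔ f u = f v)
    {u v : X ⊕ (Y ⊕ X)} (h : stack a b u v) (l : ℤ) :
    rowLabel a b f u l = rowLabel a b f v l := by
  have hq : Quotient.mk (stack a b) u = Quotient.mk (stack a b) v := Quotient.sound h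
  by_cases hex : ∃ e : X ⊕ X, stack a b (outer e) u
  · obtain ⟨e, he⟩ := hex
    rw [rowLabel_of_stack hf he, rowLabel_of_stack hf (.trans _ _ _ he h)]
  · have hu : ¬ ∃ e : X ⊕ X, Quotient.mk (stack a b) (outer e) = Quotient.mk (stack a b) u :=
      fun ⟨e, he⟩ => hex ⟨e, Quotient.exact he⟩
    have hv : ¬ ∃ e : X ⊕ X, Quotient.mk (stack a b) (outer e) = Quotient.mk (stack a b) v :=
      hq ▸ hu
    rw [rowLabel, rowLabel, dif_neg hu, dif_neg hv]
    simp only [hq]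

theorem towerLabel_bilevel (hf : ∀ u v, tower (comp a b) u v ↔ f u = f v)
    (w : X ⊕ (Y ⊕ X)) (l : ℤ) :
    towerLabel a b f (bilevel w l) = rowLabel a b f w l := by
  rcases w with x | y | x
  · exact (rowLabel_of_stack hf (e := .inl x) (.refl _) l).symm
  · rfl
  · exact (rowLabel_of_stack hf (e := .inr x) (.refl _) l).symm

theorem bitower_iff_towerLabel (hf : ∀ u v, tower (comp a b) u v ↔ f u = f v)
    (u v : (X ⊕ Y) × ℤ) :
    bitower a b u v ↔ towerLabel a b f u = towerLabel a b f v := by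
  constructor
  · have hle : bitower a b ≤ Setoid.ker (towerLabel a b f) := by
      refine bitower_le (fun p l => ?_) (fun p l => ?_)
      · rw [Setoid.ker_def, towerLabel_bilevel hf, towerLabel_bilevel hf]
        exact rowLabel_congr hf (.rel _ _ (.upper p)) l
      · rw [Setoid.ker_def, towerLabel_bilevel hf, towerLabel_bilevel hf]
        exact rowLabel_congr hf (.rel _ _ (.lower p)) l
    exact fun h => hle h
  -- Every point either is connected to the row of `X`, where the tower of `comp a b` decides, or
  -- lies in a loop confined to its own level.
  · have key : ∀ u : (X ⊕ Y) × ℤ,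
        (∃ x, bitower a b u (Prod.map Sum.inl id x) ∧ towerLabel a b f u = .inl (f x)) ∨
        ∃ y l h, u = (.inr y, l) ∧
          towerLabel a b f u = .inr (⟨Quotient.mk _ (.inr (.inl y)), h⟩, l) := by
      rintro ⟨x | y, l⟩
      · exact .inl ⟨(x, l), .refl _, rfl⟩
      · by_cases hex : ∃ e : X ⊕ X,
          Quotient.mk (stack a b) (outer e) = Quotient.mk (stack a b) (.inr (.inl y))
        · obtain ⟨e, he⟩ := hex
          refine .inl ⟨level e l, ?_, rowLabel_of_stack hf (Quotient.exact he) l⟩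
          rw [← bilevel_outer]
          exact .symm _ _ (bitower_of_stack (Quotient.exact he) l)
        · exact .inr ⟨y, l, not_exists.1 hex, rfl, by rw [towerLabel, rowLabel, dif_neg hex]⟩
    intro h
    rcases key u with ⟨x, hx, hx'⟩ | ⟨y, l, hy, rfl, hy'⟩ <;>
      rcases key v with ⟨x₂, hx₂, hx₂'⟩ | ⟨y₂, l₂, hy₂, rfl, hy₂'⟩
    · rw [hx', hx₂', Sum.inl.injEq, ← hf] at h
      exact .trans _ _ _ hx (.trans _ _ _ (bitower_of_tower_comp h) (.symm _ _ hx₂))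
    · rw [hx', hy₂'] at h
      cases h
    · rw [hy', hx₂'] at h
      cases h
    · rw [hy', hy₂', Sum.inr.injEq, Prod.mk.injEq, Subtype.mk.injEq] at h
      obtain ⟨h, rfl⟩ := h
      exact bitower_of_stack (Quotient.exact h) l

end Label

/-- Each loop of the three-row picture reappears at every level as a separate component, giving a
free orbit; all other components meet the row of `X`. -/
theorem isShiftQuotient_bitower [Finite X] [Finite Y] {T : Equiv.Perm S}
    (h : IsShiftQuotient (tower (comp a b)) T) :
    IsShiftQuotient (bitower a b) (Equiv.sumCongr T (freeShift (Loop a b))) := by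
  obtain ⟨f, h1, h2, h3⟩ := h
  refine ⟨towerLabel a b f, ?_, ?_, bitower_iff_towerLabel h3⟩
  · rintro (s | ⟨⟨c, hc⟩, l⟩)
    · obtain ⟨u, rfl⟩ := h1 s
      exact ⟨(.inl u.1, u.2), rfl⟩
    · induction c using Quotient.inductionOn with
      | h v =>
        rcases v with x | y | z
        · exact absurd rfl (hc (.inl x))
        · refine ⟨(.inr y, l), ?_⟩
          rw [towerLabel, rowLabel, dif_neg (not_exists.2 hc)]
        · exact absurd rfl (hc (.inr z))
  · have hl : ∀ (e : X ⊕ X) l, f (level e (l + 1)) = T (f (level e l)) := by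
      rintro (e | e) l
      · exact h2 e l
      · exact h2 e (l + 1)
    rintro (x | y) l
    · exact congrArg Sum.inl (h2 x l)
    · simp only [towerLabel, rowLabel]
      split_ifs with hex
      · exact congrArg Sum.inl (hl _ l)
      · rfl

theorem bitower_inl_iff [Finite X] [Finite Y] (u v : X × ℤ) :
    bitower a b (Prod.map Sum.inl id u) (Prod.map Sum.inl id v) ↔ tower (comp a b) u v := by
  have hf : ∀ u v, tower (comp a b) u v ↔
      Quotient.mk (tower (comp a b)) u = Quotient.mk (tower (comp a b)) v :=
    fun u v => Quotient.eq.symm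
  rw [bitower_iff_towerLabel hf, hf]
  exact Sum.inl_injective.eq_iff

/-- Without loops every component of the alternating tower meets the row of `X`, so restricting to
that row loses nothing. -/
theorem isShiftQuotient_tower_comp [Finite X] [Finite Y] {T : Equiv.Perm S}
    (h : IsShiftQuotient (bitower a b) T) (hab : loops a b = 0) :
    IsShiftQuotient (tower (comp a b)) T := by
  obtain ⟨f, h1, h2, h3⟩ := h
  refine ⟨fun u => f (Prod.map Sum.inl id u), fun s => ?_, fun v l => h2 _ l, fun u v => ?_⟩
  · obtain ⟨⟨x | y, l⟩, rfl⟩ := h1 s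
    · exact ⟨(x, l), rfl⟩
    · have hempty : IsEmpty (Loop a b) := by
        rcases Nat.card_eq_zero.1 hab with h | h
        · exact h
        · exact absurd h (not_infinite_iff_finite.2 inferInstance)
      obtain ⟨e, he⟩ : ∃ e : X ⊕ X,
          Quotient.mk (stack a b) (outer e) = Quotient.mk (stack a b) (.inr (.inl y)) := by
        by_contra hcon
        exact hempty.elim ⟨_, not_exists.1 hcon⟩
      refine ⟨level e l, ?_⟩
      rw [← h3, ← bilevel_outer]
      exact bitower_of_stack (Quotient.exact he) l
  · rw [← bitower_inl_iff, h3]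

/-- Both towers are the same infinite picture, grouped into pairs of layers in two ways. -/
theorem isShiftQuotient_bitower_swap {T : Equiv.Perm S}
    (h : IsShiftQuotient (bitower a b) T) : IsShiftQuotient (bitower b a) T := by
  obtain ⟨f, h1, h2, h3⟩ := h
  -- In `bitower b a` the row of `X` at level `l` comes after the row of `Y` at level `l`; in
  -- `bitower a b` that row has level `l + 1`.
  let φ : (Y ⊕ X) × ℤ → (X ⊕ Y) × ℤ := fun u =>
    u.1.elim (fun y => (.inr y, u.2)) (fun x => (.inl x, u.2 + 1))
  let ψ : (X ⊕ Y) × ℤ → (Y ⊕ X) × ℤ := fun u =>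
    u.1.elim (fun x => (.inr x, u.2 - 1)) (fun y => (.inl y, u.2))
  have hψφ : ∀ u, ψ (φ u) = u := by
    rintro ⟨y | x, l⟩ <;> simp [φ, ψ]
  have hφψ : ∀ u, φ (ψ u) = u := by
    rintro ⟨y | x, l⟩ <;> simp [φ, ψ]
  have hφu : ∀ (p : Y ⊕ X) l, φ (bilevel (upper p) l) = bilevel (lower p) l := by
    rintro (y | x) l <;> rfl
  have hφl : ∀ (p : X ⊕ Y) l, φ (bilevel (lower p) l) = bilevel (upper p) (l + 1) := by
    rintro (y | x) l <;> rfl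
  have hψu : ∀ (p : X ⊕ Y) l, ψ (bilevel (upper p) l) = bilevel (lower p) (l - 1) := by
    intro p l
    rw [← hψφ (bilevel (lower p) (l - 1)), hφl, sub_add_cancel]
  have hψl : ∀ (p : Y ⊕ X) l, ψ (bilevel (lower p) l) = bilevel (upper p) l := by
    intro p l
    rw [← hφu, hψφ]
  have hle : bitower b a ≤ (bitower a b).comap φ := by
    refine bitower_le (fun p l => ?_) (fun p l => ?_)
    · rw [Setoid.comap_rel, hφu, hφu]
      exact .rel _ _ (.lower p l)
    · rw [Setoid.comap_rel, hφl, hφl]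
      exact .rel _ _ (.upper p (l + 1))
  have hle' : bitower a b ≤ (bitower b a).comap ψ := by
    refine bitower_le (fun p l => ?_) (fun p l => ?_)
    · rw [Setoid.comap_rel, hψu, hψu]
      exact .rel _ _ (.lower p (l - 1))
    · rw [Setoid.comap_rel, hψl, hψl]
      exact .rel _ _ (.upper p l)
  refine ⟨fun u => f (φ u), fun s => ?_, ?_, fun u v => ?_⟩
  · obtain ⟨u, rfl⟩ := h1 s
    exact ⟨ψ u, congrArg f (hφψ u)⟩
  · rintro (y | x) l
    · exact h2 _ l
    · exact h2 _ (l + 1)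
  · rw [← h3]
    refine ⟨fun h => hle h, fun h => ?_⟩
    have h4 : bitower b a (ψ (φ u)) (ψ (φ v)) := hle' h
    rwa [hψφ, hψφ] at h4

end Bitower

end PerfectMatching

/-! ### Conjugacy of permutations from orbit representatives. -/

namespace Equiv.Perm

theorem zpow_apply_eq_zpow_apply_iff {A : Type*} (U : Equiv.Perm A) (x : A) (k l : ℤ) :
    (U ^ k) x = (U ^ l) x ↔ (U ^ (k - l)) x = x := by
  rw [sub_eq_neg_add, zpow_add, zpow_neg, Equiv.Perm.mul_apply, Equiv.Perm.inv_eq_iff_eq]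

/-- Two permutations with corresponding orbits of the same length are conjugate. -/
theorem exists_equiv_of_orbits {I S S' : Type*} {T : Equiv.Perm S} {T' : Equiv.Perm S'}
    {q : I → S} {q' : I → S'} (hq : ∀ s, ∃ i, ∃ k : ℤ, (T ^ k) (q i) = s)
    (hq' : ∀ s, ∃ i, ∃ k : ℤ, (T' ^ k) (q' i) = s)
    (hi : ∀ i j, ∀ k l : ℤ, (T ^ k) (q i) = (T ^ l) (q j) → i = j)
    (hi' : ∀ i j, ∀ k l : ℤ, (T' ^ k) (q' i) = (T' ^ l) (q' j) → i = j)
    (hp : ∀ i, ∀ k : ℤ, (T ^ k) (q i) = q i ↔ (T' ^ k) (q' i) = q' i) :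
    ∃ e : S ≃ S', ∀ s, e (T s) = T' (e s) := by
  have hp2 : ∀ i, ∀ k l : ℤ, (T ^ k) (q i) = (T ^ l) (q i) ↔
      (T' ^ k) (q' i) = (T' ^ l) (q' i) := by
    intro i k l
    rw [zpow_apply_eq_zpow_apply_iff, zpow_apply_eq_zpow_apply_iff, hp]
  choose i k hik using hq
  -- The exponent `k s` is an arbitrary choice; `hp2` makes the value independent of it.
  let g : S → S' := fun s => (T' ^ k s) (q' (i s))
  have hg : ∀ j (l : ℤ), g ((T ^ l) (q j)) = (T' ^ l) (q' j) := by
    intro j l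
    have h := hik ((T ^ l) (q j))
    have hj := hi _ _ _ _ h
    simp only [g]
    rw [hj] at h ⊢
    exact (hp2 _ _ _).1 h
  have hbij : Function.Bijective g := by
    constructor
    · intro s s' h
      rw [← hik s, ← hik s', hg, hg] at h
      have hj := hi' _ _ _ _ h
      rw [← hik s, ← hik s']
      rw [hj] at h ⊢
      exact (hp2 _ _ _).2 h
    · intro s
      obtain ⟨j, l, rfl⟩ := hq' s
      exact ⟨_, hg j l⟩
  refine ⟨Equiv.ofBijective g hbij, fun s => ?_⟩
  change g (T s) = T' (g s)
  rw [← hik s, hg, ← Equiv.Perm.mul_apply, ← zpow_one_add, hg, zpow_one_add,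
    Equiv.Perm.mul_apply]

end Equiv.Perm

namespace PerfectMatching

variable {S X : Type*}

/-! ### Winding numbers of the components -/

/-- The column of a dot. -/
def column : X ⊕ X → X := Sum.elim id id

theorem column_swap (p : X ⊕ X) : column p.swap = column p := by
  rcases p with p | p <;> rfl

theorem eq_or_eq_swap_of_column_eq {p q : X ⊕ X} (h : column p = column q) :
    p = q ∨ p = q.swap := by
  rcases p with p | p <;> rcases q with q | q <;> cases h <;> simp

theorem level_fst (p : X ⊕ X) (l : ℤ) : (level p l).1 = column p := by
  rcases p with p | p <;> rfl

theorem level_snd (p q : X ⊕ X) (l : ℤ) : (level q l).2 = (level p l).2 + direction p q := by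
  rcases p with p | p <;> rcases q with q | q <;> simp [level, direction]

theorem direction_comm (p q : X ⊕ X) : direction q p = - direction p q := by
  rcases p with p | p <;> rcases q with q | q <;> rfl

variable (d : PerfectMatching (X ⊕ X))

theorem tower_partner (p : X ⊕ X) (l : ℤ) :
    tower d (column p, l) (column (d.partner p), l + direction p (d.partner p)) := by
  have h : ∃ l', level p l' = (column p, l) := by
    rcases p with p | p
    · exact ⟨l, rfl⟩
    · exact ⟨l - 1, by simp [level, column]⟩
  obtain ⟨l', h⟩ := h
  have h2 : level (d.partner p) l' =
      (column (d.partner p), l + direction p (d.partner p)) := by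
    refine Prod.ext (level_fst _ _) ?_
    rw [level_snd p, h]
  rw [← h, ← h2]
  exact .rel _ _ (.arc p l')

/-- The walk along a component of a diagram, lifted to the tower. -/
def walkLift : Equiv.Perm ((X ⊕ X) × ℤ) where
  toFun u := (walk d u.1, u.2 + direction u.1 (d.partner u.1))
  invFun u := ((walk d).symm u.1,
    u.2 - direction ((walk d).symm u.1) (d.partner ((walk d).symm u.1)))
  left_inv u := by simp
  right_inv u := by simp

/-- The point of the tower below a lifted point. -/
def base (u : (X ⊕ X) × ℤ) : X × ℤ := (column u.1, u.2)

theorem tower_walkLift (u : (X ⊕ X) × ℤ) : tower d (base u) (base (walkLift d u)) := by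
  have h := tower_partner d u.1 u.2
  rwa [← column_swap (d.partner u.1)] at h

theorem tower_walkLift_zpow (i : ℤ) (u : (X ⊕ X) × ℤ) :
    tower d (base u) (base ((walkLift d ^ i) u)) := by
  induction i using Int.induction_on with
  | zero => exact .refl _
  | succ k ih =>
    rw [add_comm, zpow_one_add, Equiv.Perm.mul_apply]
    exact .trans _ _ _ ih (tower_walkLift d _)
  | pred k ih =>
    have := tower_walkLift d ((walkLift d ^ (-(k : ℤ) - 1)) u)
    rw [← Equiv.Perm.mul_apply, ← zpow_one_add, add_comm 1, sub_add_cancel] at this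
    exact .trans _ _ _ ih (.symm _ _ this)

/-- A component of the tower is a single path, so the lifted walk, run in both directions, covers
it. -/
theorem exists_walkLift_of_tower {u : (X ⊕ X) × ℤ} {v : X × ℤ} (h : tower d (base u) v) :
    ∃ i : ℤ, base ((walkLift d ^ i) u) = v := by
  have key : ∀ p l, (∃ i : ℤ, base ((walkLift d ^ i) u) = level p l) →
      ∃ i : ℤ, base ((walkLift d ^ i) u) = level (d.partner p) l := by
    rintro p l ⟨i, hi⟩
    set w := (walkLift d ^ i) u with hw
    have hc : column w.1 = column p := (congrArg Prod.fst hi).trans (level_fst p l)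
    have hl : w.2 = (level p l).2 := congrArg Prod.snd hi
    -- If the walk is at `p` itself, the edge at `p` is its next one; if it is at the other dot of
    -- the column, this edge was its previous one.
    rcases eq_or_eq_swap_of_column_eq hc with hp | hp
    · refine ⟨1 + i, ?_⟩
      rw [zpow_one_add, Equiv.Perm.mul_apply, ← hw]
      refine Prod.ext ?_ ?_
      · rw [level_fst, ← hp]
        exact column_swap _
      · rw [level_snd p, ← hl, ← hp]
        rfl
    · refine ⟨-1 + i, ?_⟩
      rw [zpow_add, zpow_neg_one, Equiv.Perm.mul_apply, ← hw]
      have h1 : (walk d).symm w.1 = d.partner p := by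
        rw [hp]
        exact congrArg d.partner (Sum.swap_swap p)
      refine Prod.ext ?_ ?_
      · rw [level_fst, ← h1]
        rfl
      · rw [level_snd p, ← hl]
        change w.2 - direction ((walk d).symm w.1) (d.partner ((walk d).symm w.1)) = _
        rw [h1, d.partner_partner, direction_comm, sub_neg_eq_add]
  have hle : tower d ≤ Setoid.ker fun v => ∃ i : ℤ, base ((walkLift d ^ i) u) = v := by
    refine tower_le fun p l => propext ⟨key p l, fun h => ?_⟩
    have := key _ _ h
    rwa [d.partner_partner] at this
  have h2 : (∃ i : ℤ, base ((walkLift d ^ i) u) = base u) =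
    ∃ i : ℤ, base ((walkLift d ^ i) u) = v := hle h
  rw [← h2]
  exact ⟨0, rfl⟩

theorem swap_walk_zpow (i : ℤ) (p : X ⊕ X) :
    ((walk d ^ i) p).swap = (walk d ^ (-i)) p.swap := by
  have h1 : ∀ p, (walk d p).swap = (walk d)⁻¹ p.swap := fun p => by
    change (d.partner p).swap.swap = d.partner p.swap.swap
    rw [Sum.swap_swap, Sum.swap_swap]
  have h2 : ∀ p, ((walk d)⁻¹ p).swap = walk d p.swap := fun p => rfl
  induction i using Int.induction_on generalizing p with
  | zero => simp
  | succ n ih =>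
    rw [add_comm, zpow_add, zpow_one, Equiv.Perm.mul_apply, h1, ih, neg_add, zpow_add,
      zpow_neg_one, Equiv.Perm.mul_apply]
  | pred n ih =>
    rw [sub_eq_neg_add, zpow_add, zpow_neg_one, Equiv.Perm.mul_apply, h2, ih,
      neg_add, neg_neg, neg_neg, zpow_add, zpow_one, Equiv.Perm.mul_apply]

/-- A walk never comes back to a column in the opposite sense. Since `swap` reverses the walk, the
midpoint of such a return would be a fixed point of `swap` (`i` even) or of `d.partner` (`i` odd).
-/
theorem walk_zpow_ne_swap (i : ℤ) (p : X ⊕ X) : (walk d ^ i) p ≠ p.swap := by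
  intro h
  rcases Int.even_or_odd' i with ⟨j, rfl | rfl⟩
  · have h1 := swap_walk_zpow d j p
    rw [← h, ← Equiv.Perm.mul_apply, ← zpow_add, two_mul, neg_add_cancel_left] at h1
    rcases h2 : (walk d ^ j) p with x | x <;> rw [h2] at h1 <;> cases h1
  · have h1 := swap_walk_zpow d (j + 1) p
    rw [← h, ← Equiv.Perm.mul_apply, ← zpow_add, add_comm j 1, zpow_one_add,
      Equiv.Perm.mul_apply] at h1
    have h2 : -(1 + j) + (2 * j + 1) = j := by ring
    rw [h2] at h1
    change (d.partner ((walk d ^ j) p)).swap.swap = _ at h1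
    rw [Sum.swap_swap] at h1
    exact d.partner_ne _ h1

theorem walkLift_zpow_fst (i : ℤ) (u : (X ⊕ X) × ℤ) :
    ((walkLift d ^ i) u).1 = (walk d ^ i) u.1 := by
  induction i using Int.induction_on with
  | zero => rfl
  | succ k ih =>
    rw [add_comm, zpow_one_add, zpow_one_add, Equiv.Perm.mul_apply, Equiv.Perm.mul_apply, ← ih]
    rfl
  | pred k ih =>
    rw [sub_eq_neg_add, zpow_add, zpow_neg_one, zpow_add, zpow_neg_one, Equiv.Perm.mul_apply,
      Equiv.Perm.mul_apply, ← ih]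
    rfl

theorem walkLift_pow (k : ℕ) (p : X ⊕ X) (l : ℤ) :
    (walkLift d ^ k) (p, l) = ((walk d ^ k) p, l + ∑ i ∈ Finset.range k,
      direction ((walk d ^ i) p) (d.partner ((walk d ^ i) p))) := by
  induction k with
  | zero => simp
  | succ k ih =>
    rw [pow_succ', pow_succ', Equiv.Perm.mul_apply, Equiv.Perm.mul_apply, ih,
      Finset.sum_range_succ, ← add_assoc]
    rfl

theorem minimalPeriod_pos [Finite X] (p : X ⊕ X) :
    0 < Function.minimalPeriod (walk d) p :=
  Function.minimalPeriod_pos_of_mem_periodicPts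
    (Function.Injective.mem_periodicPts (walk d).injective p)

/-- One period visits each point of the cycle of `p` exactly once, so the level changes by the sum
defining `netDown`. -/
theorem walkLift_minimalPeriod [Fintype X] (p : X ⊕ X) (l : ℤ) :
    (walkLift d ^ Function.minimalPeriod (walk d) p) (p, l) = (p, l + netDown d p) := by
  classical
  rw [walkLift_pow]
  have hp : ∀ k (q : X ⊕ X), (walk d ^ k) q = (walk d)^[k] q := fun k q => by
    rw [Equiv.Perm.iterate_eq_pow]
  refine Prod.ext ?_ (congrArg (l + ·) ?_)
  · rw [hp]
    exact Function.iterate_minimalPeriod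
  · rw [netDown]
    refine Finset.sum_bij (fun i _ => (walk d ^ i) p) (fun i _ => ?_) (fun i hi j hj h => ?_)
      (fun q hq => ?_) (fun _ _ => rfl)
    · exact Finset.mem_filter.2 ⟨Finset.mem_univ _, ⟨i, by simp⟩⟩
    · rw [Finset.mem_range] at hi hj
      rw [hp, hp] at h
      exact Function.iterate_injOn_Iio_minimalPeriod hi hj h
    · obtain ⟨n, hn⟩ := (Finset.mem_filter.1 hq).2.exists_nat_pow_eq
      refine ⟨n % Function.minimalPeriod (walk d) p,
        Finset.mem_range.2 (Nat.mod_lt _ (minimalPeriod_pos d p)), ?_⟩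
      rw [← hn, hp, hp, Function.iterate_mod_minimalPeriod_eq]

/-- The lifted walk is over the column of `p` only when it is at `p` again, hence after whole turns,
each changing the level by `netDown d p`. For `netDown d p = 0` no nonzero shift fixes the
component. -/
theorem tower_column_iff [Fintype X] (p : X ⊕ X) (k : ℤ) :
    tower d (column p, 0) (column p, k) ↔ netDown d p ∣ k := by
  have hj : ∀ (j : ℤ) l, ((walkLift d ^ Function.minimalPeriod (walk d) p) ^ j) (p, l) =
      (p, l + j * netDown d p) := by
    intro j
    induction j using Int.induction_on with
    | zero => simp
    | succ n ih =>
      intro l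
      rw [zpow_add_one, Equiv.Perm.mul_apply, walkLift_minimalPeriod, ih]
      congr 1
      ring
    | pred n ih =>
      intro l
      have h := walkLift_minimalPeriod d p (l - netDown d p)
      rw [sub_add_cancel] at h
      rw [← h, ← Equiv.Perm.mul_apply, ← zpow_add_one, sub_add_cancel, ih]
      congr 1
      ring
  constructor
  · intro h
    obtain ⟨i, hi⟩ := exists_walkLift_of_tower d (u := (p, 0)) h
    have hc : column ((walkLift d ^ i) (p, 0)).1 = column p := congrArg Prod.fst hi
    have hk : ((walkLift d ^ i) (p, 0)).2 = k := congrArg Prod.snd hi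
    rw [walkLift_zpow_fst] at hc
    have hp : (walk d ^ i) p = p :=
      (eq_or_eq_swap_of_column_eq hc).resolve_right (walk_zpow_ne_swap d i p)
    have hdvd : (Function.minimalPeriod (walk d) p : ℤ) ∣ i :=
      (MulAction.zpow_smul_eq_iff_minimalPeriod_dvd (a := walk d) (b := p) (n := i)).1 hp
    obtain ⟨j, rfl⟩ := hdvd
    rw [zpow_mul, zpow_natCast, hj, zero_add] at hk
    exact ⟨j, by rw [← hk, mul_comm]⟩
  · rintro ⟨j, rfl⟩
    have h := tower_walkLift_zpow d (Function.minimalPeriod (walk d) p * j) (p, 0)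
    rw [zpow_mul, zpow_natCast, hj, zero_add, mul_comm] at h
    exact h

theorem closure_of_tower {d : PerfectMatching (X ⊕ X)} {u v : X × ℤ} (h : tower d u v) :
    closure d (.inl u.1) (.inl v.1) := by
  have hc : ∀ p, closure d (.inl (column p)) p := by
    rintro (p | p)
    · exact .refl _
    · exact .rel _ _ (.column (.inl p))
  have hle : tower d ≤ (closure d).comap fun u => .inl u.1 := by
    refine tower_le fun p l => ?_
    rw [Setoid.comap_rel, level_fst, level_fst]
    exact .trans _ _ _ (hc p) (.trans _ _ _ (.rel _ _ (.arc p)) (.symm _ _ (hc _)))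
  exact hle h

/-- An arc lifts to the tower up to a shift, and a column edge does not move. With
`closure_of_tower`, this identifies shift orbits in the tower with components of the closure. -/
theorem sameCycle_of_closure {d : PerfectMatching (X ⊕ X)} {T : Equiv.Perm S} {f : X × ℤ → S}
    (hT : ∀ v, ∀ k : ℤ, (T ^ k) (f (v, 0)) = f (v, k))
    (hf : ∀ u v, tower d u v ↔ f u = f v) {p q : X ⊕ X} (h : closure d p q) :
    T.SameCycle (f (column p, 0)) (f (column q, 0)) := by
  have hle : closure d ≤
      (Equiv.Perm.SameCycle.setoid T).comap fun p : X ⊕ X => f (column p, 0) := by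
    refine Setoid.eqvGen_le ?_
    rintro p _ (_ | _)
    · have h1 := (hf _ _).1 (tower_partner d p 0)
      have h2 : T.SameCycle (f (column (d.partner p), 0)) (f (column p, 0)) :=
        ⟨0 + direction p (d.partner p), by rw [hT, h1]⟩
      exact h2.symm
    · change T.SameCycle (f (column p, 0)) (f (column p.swap, 0))
      rw [column_swap]
  exact hle h

end PerfectMatching

/-! ### The cycle type as a complete invariant of the tower. -/

theorem exists_equiv_of_map_univ_eq {α β γ : Type*} [Fintype α] [Fintype β] {f : α → γ}
    {g : β → γ} (h : (Finset.univ : Finset α).val.map f = (Finset.univ : Finset β).val.map g) :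
    ∃ e : α ≃ β, ∀ a, g (e a) = f a := by
  classical
  have hc : ∀ c, Nonempty ({a // f a = c} ≃ {b // g b = c}) := by
    intro c
    have h1 := congrArg (Multiset.count c) h
    rw [Multiset.count_map, Multiset.count_map] at h1
    rw [← Fintype.card_eq, Fintype.card_subtype, Fintype.card_subtype]
    simpa [Finset.card_def, Finset.filter_val, eq_comm] using h1
  exact ⟨Equiv.ofFiberEquiv fun c => (hc c).some, fun a => Equiv.ofFiberEquiv_map _ a⟩

namespace PerfectMatching

/-- Every component of the closure supplies one shift orbit, with stabilizer generated by its
component number. -/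
theorem exists_transversal {S X : Type*} [Fintype X] {d : PerfectMatching (X ⊕ X)}
    {T : Equiv.Perm S} (h : IsShiftQuotient (tower d) T) :
    ∃ q : Quotient (closure d) → S, (∀ s, ∃ i, ∃ k : ℤ, (T ^ k) (q i) = s) ∧
      (∀ i j, ∀ k l : ℤ, (T ^ k) (q i) = (T ^ l) (q j) → i = j) ∧
      ∀ i, ∀ k : ℤ, (T ^ k) (q i) = q i ↔ (componentNumber d i : ℤ) ∣ k := by
  obtain ⟨f, h1, h2, h3⟩ := h
  have hT : ∀ v, ∀ k : ℤ, (T ^ k) (f (v, 0)) = f (v, k) := by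
    intro v k
    induction k using Int.induction_on with
    | zero => rfl
    | succ k ih => rw [add_comm, zpow_one_add, Equiv.Perm.mul_apply, ih, ← h2, add_comm]
    | pred k ih =>
      rw [sub_eq_neg_add, zpow_add, zpow_neg_one, Equiv.Perm.mul_apply, ih,
        Equiv.Perm.inv_eq_iff_eq, ← h2, neg_add_cancel_comm]
  have hcol : ∀ p : X ⊕ X, closure d (.inl (column p)) p := by
    rintro (p | p)
    · exact .refl _
    · exact .rel _ _ (.column (.inl p))
  refine ⟨fun i => f (column i.out, 0), fun s => ?_, fun i j k l hij => ?_, fun i k => ?_⟩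
  · obtain ⟨⟨x, l⟩, rfl⟩ := h1 s
    have hc : closure d (Quotient.mk (closure d) (.inl x)).out (.inl x) :=
      Quotient.exact (Quotient.out_eq _)
    obtain ⟨k, hk⟩ := sameCycle_of_closure hT h3 hc
    refine ⟨Quotient.mk (closure d) (.inl x), l + k, ?_⟩
    rw [zpow_add, Equiv.Perm.mul_apply, hk]
    exact hT x l
  · rw [hT, hT, ← h3] at hij
    rw [← Quotient.out_eq i, ← Quotient.out_eq j]
    exact Quotient.sound (.trans _ _ _ (.symm _ _ (hcol _))
      (.trans _ _ _ (closure_of_tower hij) (hcol _)))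
  · have hi : componentNumber d i = (netDown d i.out).natAbs := by
      conv_lhs => rw [← Quotient.out_eq i]
      rfl
    rw [hT, hi, Int.natAbs_dvd, ← tower_column_iff, h3, eq_comm]

/-- Diagrams with the same cycle type have isomorphic towers. -/
theorem exists_equiv_of_cycleType_eq {S S' X X' : Type*} [Fintype X] [Fintype X']
    {d : PerfectMatching (X ⊕ X)} {d' : PerfectMatching (X' ⊕ X')}
    (h : d.cycleType = d'.cycleType) {T : Equiv.Perm S} {T' : Equiv.Perm S'}
    (hT : IsShiftQuotient (tower d) T) (hT' : IsShiftQuotient (tower d') T') :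
    ∃ e : S ≃ S', ∀ s, e (T s) = T' (e s) := by
  let _ : Fintype (Quotient (closure d)) := Fintype.ofFinite _
  let _ : Fintype (Quotient (closure d')) := Fintype.ofFinite _
  obtain ⟨e, he⟩ := exists_equiv_of_map_univ_eq
    (f := componentNumber d) (g := componentNumber d') h
  obtain ⟨q, h1, h2, h3⟩ := exists_transversal hT
  obtain ⟨q', h1', h2', h3'⟩ := exists_transversal hT'
  refine Equiv.Perm.exists_equiv_of_orbits (q := q) (q' := q' ∘ e) h1 (fun s => ?_) h2
    (fun i j k l hij => e.injective (h2' _ _ k l hij)) fun i k => ?_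
  · obtain ⟨i, k, rfl⟩ := h1' s
    exact ⟨e.symm i, k, by simp⟩
  · rw [h3, Function.comp_apply, h3', he]

/-- Points of the finite set `Z` are periodic, whereas the shift of `M' × ℤ` has no periodic points.
-/
theorem exists_eq_inl_of_sumCongr_freeShift {Z Z' M M' : Type*} [Finite Z]
    {σ : Equiv.Perm Z} {σ' : Equiv.Perm Z'} (e : Z ⊕ (M × ℤ) → Z' ⊕ (M' × ℤ))
    (he : ∀ s, e (Equiv.sumCongr σ (freeShift M) s) = Equiv.sumCongr σ' (freeShift M') (e s))
    (z : Z) : ∃ z', e (.inl z) = .inl z' := by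
  rcases hz : e (.inl z) with z' | ⟨m, l⟩
  · exact ⟨z', rfl⟩
  · have hk : ∀ k : ℕ, e (.inl (σ^[k] z)) = .inr (m, l + k) := by
      intro k
      induction k with
      | zero => simpa using hz
      | succ k ih =>
        rw [Function.iterate_succ_apply']
        have h := he (.inl (σ^[k] z))
        rw [ih] at h
        refine h.trans ?_
        simp [freeShift, add_assoc]
    obtain ⟨k, hk0, hkz⟩ := Function.Injective.mem_periodicPts σ.injective z
    have h := hk k
    rw [hkz.eq, hz, Sum.inr.injEq, Prod.mk.injEq] at h
    omega

/-- The finite orbits and the number of infinite orbits are determined by the union of a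
permutation of a finite set with copies of `ℤ`. -/
theorem exists_conj_of_sumCongr_freeShift {Z Z' M M' : Type*} [Finite Z] [Finite Z']
    {σ : Equiv.Perm Z} {σ' : Equiv.Perm Z'} (e : Z ⊕ (M × ℤ) ≃ Z' ⊕ (M' × ℤ))
    (he : ∀ s, e (Equiv.sumCongr σ (freeShift M) s) = Equiv.sumCongr σ' (freeShift M') (e s)) :
    (∃ c : Z ≃ Z', ∀ z, c (σ z) = σ' (c z)) ∧ Nat.card M = Nat.card M' := by
  have he' : ∀ s, e.symm (Equiv.sumCongr σ' (freeShift M') s) =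
      Equiv.sumCongr σ (freeShift M) (e.symm s) := by
    intro s
    rw [Equiv.symm_apply_eq, he, Equiv.apply_symm_apply]
  have h1 := exists_eq_inl_of_sumCongr_freeShift e he
  have h2 := exists_eq_inl_of_sumCongr_freeShift e.symm he'
  have h3 : ∀ m l, ∃ n k, e (.inr (m, l)) = .inr (n, k) := by
    intro m l
    rcases h : e (.inr (m, l)) with z | ⟨n, k⟩
    · obtain ⟨z', hz'⟩ := h2 z
      rw [← h, Equiv.symm_apply_apply] at hz'
      cases hz'
    · exact ⟨n, k, rfl⟩
  constructor
  · choose c hc using h1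
    refine ⟨Equiv.ofBijective c ⟨fun z z' h => ?_, fun z => ?_⟩, fun z => ?_⟩
    · have h4 := (hc z).trans ((congrArg _ h).trans (hc z').symm)
      exact Sum.inl_injective (e.injective h4)
    · obtain ⟨z', hz'⟩ := h2 z
      rw [Equiv.symm_apply_eq, hc] at hz'
      exact ⟨z', Sum.inl_injective hz'.symm⟩
    · have h4 := he (.inl z)
      rw [hc] at h4
      exact Sum.inl_injective ((hc (σ z)).symm.trans h4)
  -- Each line `{m} × ℤ` is carried to the line of `g m`, translated by `k m`.
  · choose g k hg using fun m => h3 m 0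
    have hl : ∀ m (l : ℤ), e (.inr (m, l)) = .inr (g m, k m + l) := by
      intro m l
      have hs : ∀ l n j, e (.inr (m, l)) = .inr (n, j) → e (.inr (m, l + 1)) = .inr (n, j + 1) := by
        intro l n j h
        have h4 := he (.inr (m, l))
        rw [h] at h4
        exact h4
      induction l using Int.induction_on with
      | zero => rw [hg, add_zero]
      | succ l ih => rw [hs _ _ _ ih, add_assoc]
      | pred l ih =>
        obtain ⟨n, j, h⟩ := h3 m (-l - 1)
        have h4 := hs _ _ _ h
        rw [sub_add_cancel, ih, Sum.inr.injEq, Prod.mk.injEq] at h4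
        rw [h, h4.1]
        congr 2
        omega
    refine Nat.card_congr (Equiv.ofBijective g ⟨fun m m' h => ?_, fun n => ?_⟩)
    -- These arguments are chosen so that both translations end at level `k m + k m'`.
    · have h4 : e (.inr (m, k m')) = e (.inr (m', k m)) := by rw [hl, hl, h, add_comm]
      exact (Prod.mk.injEq _ _ _ _ ▸ Sum.inr_injective (e.injective h4)).1
    · rcases h : e.symm (.inr (n, 0)) with z | ⟨m, l⟩
      · rw [Equiv.symm_apply_eq] at h
        obtain ⟨z', hz'⟩ := h1 z
        rw [hz'] at h
        cases h
      · rw [Equiv.symm_apply_eq, hl, Sum.inr.injEq, Prod.mk.injEq] at h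
        exact ⟨m, h.1.symm⟩

end PerfectMatching

/-! ### Reduction to permutations and conclusion. -/

namespace BrauerAlgebra

open PerfectMatching Matrix

variable {F : Type*} [Field F] {δ : F} {r n : ℕ}
  (ρ : BrauerAlgebra F r δ →ₐ[F] Matrix (Fin n) (Fin n) F)

theorem scaled_eq_mul_cut {X : Type*} [Finite X] (d : PerfectMatching (X ⊕ X)) :
    d.scaled = (cutUpper d).scaled.mul (cutLower d).scaled := by
  ext1
  · simp [scaled, Scaled.mul, loops_cut]
  · exact (comp_cut d).symm

/-- Every diagram can be reduced to a permutation with some additional loops, keeping the nonzero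
spectrum and the tower. -/
theorem exists_perm_of_retraction (N : ℕ) : ∀ (X : Type) [Finite X], Nat.card X = N →
    N ≤ r → Even (N + r) → ∀ (d : PerfectMatching (X ⊕ X)) (R : Retraction X (Fin r)) (k : ℕ),
    ∃ (Z : Type) (_ : Finite Z) (S : Retraction Z (Fin r)) (σ : Equiv.Perm Z) (M : Type)
      (_ : Finite M),
      SameNonzeroSpectrum (compress ρ R (d.scaled.addLoops k))
        (compress ρ S ((ofEquiv σ).scaled.addLoops (k + Nat.card M))) ∧
      IsShiftQuotient (tower d) (Equiv.sumCongr σ⁻¹ (freeShift M)) := by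
  induction N using Nat.strong_induction_on with
  | _ N ih =>
    intro X _ hX hN hr d R k
    by_cases hd : ∀ x, ∃ y, d.partner (.inl x) = .inr y
    · obtain ⟨σ, rfl⟩ := exists_eq_ofEquiv d hd
      refine ⟨X, inferInstance, R, σ, Empty, inferInstance, ?_, ?_⟩
      · rw [Nat.card_eq_zero.2 (.inl inferInstance), add_zero]
        exact .refl _
      · refine (isShiftQuotient_tower_ofEquiv σ).congr (Equiv.sumEmpty X (Empty × ℤ)).symm ?_
        intro s
        rfl
    · have hlt : Nat.card (Through d) < N := by
        rw [← hX]
        push Not at hd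
        obtain ⟨x, hx⟩ := hd
        rcases h : d.partner (.inl x) with y | y
        · exact card_through_lt d h
        · exact absurd h (hx y)
      have hle : Nat.card (Through d) ≤ r := by omega
      have heven : Even (Nat.card (Through d) + r) := by
        have h := even_natCard_add (cutUpper d)
        rw [hX] at h
        rw [Nat.even_add] at h hr ⊢
        exact h.symm.trans hr
      obtain ⟨S⟩ : Nonempty (Retraction (Through d) (Fin r)) :=
        Retraction.nonempty_of_card_le (by simpa using hle) (by simpa using heven)
      -- The induction continues with the two halves of `d` multiplied in the opposite order; the
      -- loops formed by this are added to `k`.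
      obtain ⟨Z, _, S', σ, M, _, h1, h2⟩ := ih _ hlt (Through d) rfl hle heven
        (comp (cutLower d) (cutUpper d)) S (k + loops (cutLower d) (cutUpper d))
      refine ⟨Z, inferInstance, S', σ, M ⊕ Loop (cutLower d) (cutUpper d), inferInstance, ?_, ?_⟩
      · have h3 : Nat.card (Loop (cutLower d) (cutUpper d)) =
          loops (cutLower d) (cutUpper d) := rfl
        rw [Nat.card_sum, h3, add_comm (Nat.card M), ← add_assoc]
        refine .trans ?_ h1
        have h4 := compress_mul_comm ρ R S ((cutUpper d).scaled.addLoops k) (cutLower d).scaled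
        rw [Scaled.addLoops_mul, ← scaled_eq_mul_cut, Scaled.mul_addLoops] at h4
        convert h4 using 2
        ext1
        · simp [scaled, Scaled.mul, Scaled.addLoops]
        · rfl
      -- From the tower of the reversed product to the alternating tower, which adds its loops as
      -- free orbits, then regrouped to the tower of `d`, where cutting created no loops.
      · have h3 := isShiftQuotient_tower_comp
          (isShiftQuotient_bitower_swap (isShiftQuotient_bitower h2)) (loops_cut d)
        rw [comp_cut] at h3
        refine h3.congr ((Equiv.sumAssoc _ _ _).trans
          (Equiv.sumCongr (Equiv.refl Z) (Equiv.sumProdDistrib _ _ _).symm)) ?_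
        rintro ((z | ⟨m, l⟩) | ⟨m, l⟩) <;> rfl

theorem sameNonzeroSpectrum_of_cycleType_eq {d₁ d₂ : BrauerDiagram r}
    (hd : d₁.cycleType = d₂.cycleType) :
    SameNonzeroSpectrum (ρ (ofDiagram δ d₁)) (ρ (ofDiagram δ d₂)) := by
  -- The reduction starts at the trivial retraction, for which `compress` is `ρ` itself.
  have hred := fun d : BrauerDiagram r => exists_perm_of_retraction ρ r (Fin r) (by simp) le_rfl
    ⟨r, rfl⟩ d (.ofEquiv (Equiv.refl _)) 0
  simp only [Scaled.addLoops_zero, compress_ofEquiv_refl, zero_add] at hred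
  obtain ⟨Z, _, S, σ, M, _, h1, h2⟩ := hred d₁
  obtain ⟨Z', _, S', σ', M', _, h1', h2'⟩ := hred d₂
  obtain ⟨e, he⟩ := exists_equiv_of_cycleType_eq hd h2 h2'
  obtain ⟨⟨c, hc⟩, hM⟩ := exists_conj_of_sumCongr_freeShift e he
  refine h1.trans (.trans ?_ h1'.symm)
  rw [← hM]
  -- The towers see `σ⁻¹` and `σ'⁻¹`; a bijection that intertwines the inverses also intertwines `σ`
  -- and `σ'`.
  have hσ : ∀ z, c (σ z) = σ' (c z) := by
    intro z
    exact Equiv.Perm.inv_eq_iff_eq.1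
      ((hc (σ z)).symm.trans (congrArg c (σ.symm_apply_apply z)))
  -- In diagram order `σ` is `c` followed by `c⁻¹σ`, and the opposite order gives the conjugate
  -- `σ'`. The common number of loops is carried along.
  have h3 := compress_mul_comm ρ S S' ((ofEquiv c).scaled.addLoops (Nat.card M))
    (ofEquiv (c.symm.trans σ)).scaled
  have hmul : ∀ {A B C : Type} [Finite A] [Finite B] [Finite C] (f : A ≃ B) (g : B ≃ C),
      (ofEquiv f).scaled.mul (ofEquiv g).scaled = (ofEquiv (f.trans g)).scaled := by
    intro A B C _ _ _ f g
    ext1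
    · simp [scaled, Scaled.mul, loops_ofEquiv_left]
    · exact comp_ofEquiv f g
  rw [Scaled.addLoops_mul, Scaled.mul_addLoops, hmul, hmul] at h3
  have hl : c.trans (c.symm.trans σ) = σ := by
    ext z
    simp
  have hr : (c.symm.trans σ).trans c = σ' := by
    ext z
    simp [hσ]
  rwa [hl, hr] at h3

end BrauerAlgebra

theorem mainTheorem6 {F : Type*} [Field F] (δ : F) (r n : ℕ)
    (ρ : BrauerAlgebra F r δ →ₐ[F] Matrix (Fin n) (Fin n) F) (d₁ d₂ : BrauerDiagram r)
    (hd : d₁.cycleType = d₂.cycleType) :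
    (ρ (.ofDiagram δ d₁)).charpoly = (ρ (.ofDiagram δ d₂)).charpoly ∧
    (ρ (.ofDiagram δ d₁)).charpoly.aroots (AlgebraicClosure F) =
      (ρ (.ofDiagram δ d₂)).charpoly.aroots (AlgebraicClosure F) ∧
    (∃ k : ℕ,
      minpoly F (ρ (.ofDiagram δ d₁)) = Polynomial.X ^ k * minpoly F (ρ (.ofDiagram δ d₂)) ∨
      minpoly F (ρ (.ofDiagram δ d₂)) = Polynomial.X ^ k * minpoly F (ρ (.ofDiagram δ d₁))) ∧
    (∀ μ : F, μ ≠ 0 →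
      (Module.End.HasEigenvalue (Matrix.toLin' (ρ (.ofDiagram δ d₁))) μ ↔
        Module.End.HasEigenvalue (Matrix.toLin' (ρ (.ofDiagram δ d₂))) μ)) ∧
    (∀ μ : F, μ ≠ 0 →
      Module.finrank F (Module.End.eigenspace (Matrix.toLin' (ρ (.ofDiagram δ d₁))) μ) =
        Module.finrank F (Module.End.eigenspace (Matrix.toLin' (ρ (.ofDiagram δ d₂))) μ)) := by
  have h := BrauerAlgebra.sameNonzeroSpectrum_of_cycleType_eq ρ hd
  exact ⟨h.charpoly_eq, by rw [h.charpoly_eq], h.minpoly_eq_X_pow_mul,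
    fun _ => h.hasEigenvalue_iff, h.finrank_eq⟩
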